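/- Let $M$ be a smooth finite-dimensional Hausdorff manifold without boundary, $E\to M$ a smooth real vector bundle of finite rank, $\pi:A\to M$ a smooth affine bundle modelled on $E$, and $f:A\to\mathbb R$ a smooth function. For $a\in A_x$ let $\mathrm{vl}_a:E_x\to V_aA=\operatorname{Ker}T_a\pi$ be the vertical lift, i.e. the isomorphism sending $e$ to the velocity at $t=0$ of $t\mapsto a+te$. Let $\mathcal F=Df:A\to E^*$ be the fibre derivative of $f$, where $\mathcal F(a)\in E_x^*$ is the derivative at $a$ of $f|_{A_x}$. Let $D^2f(a)=D(\mathcal F|_{A_x})(a):E_x\to E_x^*$ be the fibre hessian, and let $\widehat{\mathcal W}_a:V_aA\to V_a^*A$ be the linear map with $\langle\widehat{\mathcal W}_a(\mathrm{vl}_a e),\mathrm{vl}_a e'\rangle=D^2f(a)(e)(e')$. For a smooth real function $h$ on an open subset of $E^*$, let $\Gamma_h(a)=\mathrm{vl}_a\big(\gamma_h(a)\big)$, where $\gamma_h(a)\in E_x\cong E_x^{**}$ is the derivative of $h|_{E_x^*}$ at $\mathcal F(a)$. Suppose that $f$ is almost regular: $\mathcal F$ has connected fibres, and its image $\mathcal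 F(A)$ is a closed embedded submanifold of $E^*$ onto which $\mathcal F$ is a submersion. Then: 1. $\operatorname{Ker}\widehat{\mathcal W}_a=\operatorname{Ker}T_a\mathcal F$ for every $a\in A$. 2. $\mathcal F(A)$ is locally defined by the vanishing of independent functions: every $p\in\mathcal F(A)$ has an open neighbourhood $U\subset E^*$ for which there are finitely many smooth functions $\phi_1,\dots,\phi_k:E^*\to\mathbb R$ whose differentials are linearly independent at every point of $U$ and such that $\mathcal F(A)\cap U=\{q\in U:\phi_1(q)=\dots=\phi_k(q)=0\}$. 3. Let $U\subset E^*$ be any open set and let $\phi_1,\dots,\phi_k$ be any smooth functions on $U$ such that $\mathcal F(A)\cap U$ is the set of their common zeros in $U$ and their differentials are linearly independent at every point of $\mathcal F(A)\cap U$. Then the vertical vector fields $\Gamma_{\phi_1},\dots,\Gamma_{\phi_k}$ form a frame of $\operatorname{Ker}\widehat{\mathcal W}=\operatorname{Ker}T\mathcal F$ on $\mathcal F^{-1}(U)$: they are smooth there, and at every $a\in\mathcal F^{-1}(U)$ their values are a basis of $\operatorname{Ker}\widehat{\mathcal W}_a=\operatorname{Ker}T_a\mathcal F$. -/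

import Mathlib

open scoped Manifold ContDiff Topology
open Bundle

noncomputable section

namespace FibreDerivative

/-! ### Affine bundles -/

section Bundles

variable {EB HB M EA HA : Type*} (F : Type*) (E A : M → Type*)
  [NormedAddCommGroup EB] [NormedSpace ℝ EB] [TopologicalSpace HB]
  (IB : ModelWithCorners ℝ EB HB) [TopologicalSpace M] [ChartedSpace HB M]
  [NormedAddCommGroup F] [NormedSpace ℝ F]
  [∀ x, AddCommGroup (E x)] [∀ x, Module ℝ (E x)] [∀ x, TopologicalSpace (E x)]
  [TopologicalSpace (TotalSpace F E)] [FiberBundle F E]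
  [NormedAddCommGroup EA] [NormedSpace ℝ EA] [TopologicalSpace HA]
  (IA : ModelWithCorners ℝ EA HA)
  [TopologicalSpace (TotalSpace F A)] [ChartedSpace HA (TotalSpace F A)]
  [∀ x, AddTorsor (E x) (A x)]

/-- A smooth affine bundle `A → M` modelled on the vector bundle `E → M` with typical fibre `F`.
The total space of `A` is a manifold, every fibre `A x` is an affine space over `E x`, and, over
the members of an open cover of `M`, there is a section `s` of `A` for which
`E|_U → A|_U`, `v ↦ v + s`, is a diffeomorphism, with inverse `a ↦ a - s`. -/
class SmoothAffineBundle : Prop where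
  contMDiff_proj : ContMDiff IA IB ∞ (π F A)
  exists_section : ∀ x : M, ∃ U : Set M, IsOpen U ∧ x ∈ U ∧ ∃ s : ∀ y, A y,
    ContMDiffOn (IB.prod 𝓘(ℝ, F)) IA ∞
      (fun v : TotalSpace F E => (⟨v.1, v.2 +ᵥ s v.1⟩ : TotalSpace F A)) (π F E ⁻¹' U) ∧
    ContMDiffOn IA (IB.prod 𝓘(ℝ, F)) ∞
      (fun a : TotalSpace F A => (⟨a.1, a.2 -ᵥ s a.1⟩ : TotalSpace F E)) (π F A ⁻¹' U)

end Bundles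

/-! ### The vertical bundle and the vertical lift -/

section Vertical

variable {EB HB M EA HA F : Type*} {E A : M → Type*}
  [NormedAddCommGroup EB] [NormedSpace ℝ EB] [TopologicalSpace HB]
  (IB : ModelWithCorners ℝ EB HB) [TopologicalSpace M] [ChartedSpace HB M]
  [NormedAddCommGroup F] [NormedSpace ℝ F]
  [∀ x, AddCommGroup (E x)] [∀ x, Module ℝ (E x)] [∀ x, TopologicalSpace (E x)]
  [TopologicalSpace (TotalSpace F E)] [FiberBundle F E] [VectorBundle ℝ F E]
  [NormedAddCommGroup EA] [NormedSpace ℝ EA] [TopologicalSpace HA]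
  (IA : ModelWithCorners ℝ EA HA)
  [TopologicalSpace (TotalSpace F A)] [ChartedSpace HA (TotalSpace F A)]
  [∀ x, AddTorsor (E x) (A x)]

/-- The vertical space `V_a A = Ker T_a π`. -/
def verticalSpace (a : TotalSpace F A) : Submodule ℝ (TangentSpace IA a) :=
  LinearMap.ker (mfderiv IA IB (π F A) a).toLinearMap

/-- The straight line `t ↦ a + t e` in the fibre of `a`. -/
def fibreLine (a : TotalSpace F A) (e : E a.1) (t : ℝ) : TotalSpace F A := ⟨a.1, t • e +ᵥ a.2⟩

/-- The velocity at `t = 0` of the line `t ↦ a + t e`. -/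
def lineVelocity (a : TotalSpace F A) (e : E a.1) : TangentSpace IA a :=
  mfderiv 𝓘(ℝ, ℝ) IA (fibreLine a e) 0 (1 : ℝ)

/-- Charts of `A` near `a` and of the fibre through `a`, both coming from a local section and from
a local trivialization of `E`. -/
theorem exists_fibre_chart [ContMDiffVectorBundle ∞ F E IB] [SmoothAffineBundle F E A IB IA]
    (a : TotalSpace F A) :
    ∃ (L : E a.1 ≃ₗ[ℝ] F) (v₀ : F) (H : M × F → TotalSpace F A) (R : TotalSpace F A → F),
      (∀ e : E a.1, ∀ t : ℝ, fibreLine a e t = H (a.1, v₀ + t • L e)) ∧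
      H (a.1, v₀) = a ∧ R a = v₀ ∧
      MDifferentiableAt (IB.prod 𝓘(ℝ, F)) IA H (a.1, v₀) ∧
      MDifferentiableAt IA 𝓘(ℝ, F) R a ∧
      (∀ v, R (H (a.1, v)) = v) ∧ (∀ v, (H (a.1, v)).1 = a.1) ∧
      (∀ᶠ b in 𝓝 a, H (b.1, R b) = b) := by
  obtain ⟨U, hU, haU, s, hΨ, hΘ⟩ :=
    SmoothAffineBundle.exists_section (F := F) (E := E) (A := A) (IB := IB) (IA := IA) a.1
  have hπ : Continuous (π F A) :=
    (SmoothAffineBundle.contMDiff_proj (F := F) (E := E) (A := A) (IB := IB) (IA := IA)).continuous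
  set e := trivializationAt F E a.1 with he
  have hx : a.1 ∈ e.baseSet := mem_baseSet_trivializationAt F E a.1
  let Ψ : TotalSpace F E → TotalSpace F A := fun v => ⟨v.1, v.2 +ᵥ s v.1⟩
  let Θ : TotalSpace F A → TotalSpace F E := fun b => ⟨b.1, b.2 -ᵥ s b.1⟩
  have hΘΨ : ∀ z, Θ (Ψ z) = z := fun z => by simp [Θ, Ψ]
  have hΨΘ : ∀ z, Ψ (Θ z) = z := fun z => by simp [Θ, Ψ]
  let L : E a.1 ≃ₗ[ℝ] F := (e.continuousLinearEquivAt ℝ a.1 hx).toLinearEquiv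
  have heL : ∀ w : E a.1, e ⟨a.1, w⟩ = (a.1, L w) := fun w =>
    e.apply_eq_prod_continuousLinearEquivAt ℝ a.1 hx w
  have hsymm : ∀ w : E a.1, e.toOpenPartialHomeomorph.symm (a.1, L w) = ⟨a.1, w⟩ := fun w => by
    rw [← heL w]
    exact e.toOpenPartialHomeomorph.left_inv (e.mem_source.2 hx)
  have hΨa : ContMDiffAt (IB.prod 𝓘(ℝ, F)) IA ∞ Ψ (Θ a) :=
    hΨ.contMDiffAt ((hU.preimage (FiberBundle.continuous_proj F E)).mem_nhds haU)
  have hΘa : ContMDiffAt IA (IB.prod 𝓘(ℝ, F)) ∞ Θ a :=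
    hΘ.contMDiffAt ((hU.preimage hπ).mem_nhds haU)
  have hes : e.toOpenPartialHomeomorph.symm (a.1, L (a.2 -ᵥ s a.1)) = Θ a := hsymm _
  refine ⟨L, L (a.2 -ᵥ s a.1), fun z => Ψ (e.toOpenPartialHomeomorph.symm z),
    fun b => (e (Θ b)).2, ?_, ?_, ?_, ?_, ?_, ?_, ?_, ?_⟩
  · intro w t
    beta_reduce
    rw [← map_smul, ← map_add, hsymm]
    simp [Ψ, fibreLine, add_comm (a.2 -ᵥ s a.1), add_vadd]
  · beta_reduce
    rw [hes, hΨΘ]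
  · change (e ⟨a.1, a.2 -ᵥ s a.1⟩).2 = _
    rw [heL]
  · have h1 : ContMDiffAt (IB.prod 𝓘(ℝ, F)) (IB.prod 𝓘(ℝ, F)) ∞
        e.toOpenPartialHomeomorph.symm (a.1, L (a.2 -ᵥ s a.1)) :=
      (e.contMDiffOn_symm (IB := IB) (n := ∞)).contMDiffAt
        (e.open_target.mem_nhds (e.mem_target.2 hx))
    rw [← hes] at hΨa
    exact (hΨa.comp _ h1).mdifferentiableAt (by simp)
  · have h1 : ContMDiffAt (IB.prod 𝓘(ℝ, F)) (IB.prod 𝓘(ℝ, F)) ∞ e (Θ a) :=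
      (e.contMDiffOn (IB := IB) (n := ∞)).contMDiffAt
        (e.open_source.mem_nhds (e.mem_source.2 hx))
    exact (contMDiffAt_snd.comp _ (h1.comp _ hΘa)).mdifferentiableAt (by simp)
  · intro v
    obtain ⟨w, rfl⟩ := L.surjective v
    simp only [hsymm, hΘΨ, heL]
  · intro v
    obtain ⟨w, rfl⟩ := L.surjective v
    simp only [hsymm, Ψ]
  · filter_upwards [(e.open_baseSet.preimage hπ).mem_nhds hx] with b hb
    have h1 : e (Θ b) = (b.1, (e (Θ b)).2) := Prod.ext (e.coe_fst' hb) rfl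
    have h2 : Θ b ∈ e.source := e.mem_source.2 hb
    have h3 : e.toOpenPartialHomeomorph.symm (e (Θ b)) = Θ b :=
      e.toOpenPartialHomeomorph.left_inv h2
    rw [← h1, h3, hΨΘ]

/-- The velocity of `t ↦ a + t e` depends linearly and injectively on `e`, and these velocities
are the vertical vectors at `a`. -/
theorem exists_linear_lineVelocity [ContMDiffVectorBundle ∞ F E IB]
    [SmoothAffineBundle F E A IB IA] (a : TotalSpace F A) :
    ∃ l : E a.1 →ₗ[ℝ] TangentSpace IA a, (∀ e, l e = lineVelocity IA a e) ∧
      Function.Injective l ∧ LinearMap.range l = verticalSpace IB IA a := by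
  obtain ⟨L, v₀, H, R, hline, hHa, hRa, hH, hR, hRH, hH1, hHR⟩ :=
    exists_fibre_chart (E := E) IB IA a
  have hπ : MDifferentiableAt IA IB (π F A) a :=
    (SmoothAffineBundle.contMDiff_proj (F := F) (E := E) (A := A) (IB := IB)
      (IA := IA)).mdifferentiable (by simp) a
  -- the chart of the fibre
  let G : F → TotalSpace F A := fun v => H (a.1, v)
  have hGa : G v₀ = a := hHa
  have hι : HasMFDerivAt 𝓘(ℝ, F) (IB.prod 𝓘(ℝ, F)) (fun v : F => (a.1, v)) v₀
      (ContinuousLinearMap.inr ℝ EB F) :=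
    (hasMFDerivAt_const a.1 v₀).prodMk (hasMFDerivAt_id v₀)
  let T : EB × F →L[ℝ] EA := mfderiv (IB.prod 𝓘(ℝ, F)) IA H (a.1, v₀)
  have hG : HasMFDerivAt 𝓘(ℝ, F) IA G v₀ (T.comp (ContinuousLinearMap.inr ℝ EB F)) :=
    hH.hasMFDerivAt.comp v₀ hι
  let dR : EA →L[ℝ] F := mfderiv IA 𝓘(ℝ, F) R a
  let dπ : EA →L[ℝ] EB := mfderiv IA IB (π F A) a
  have hRd : HasMFDerivAt IA 𝓘(ℝ, F) R (G v₀) dR := by rw [hGa]; exact hR.hasMFDerivAt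
  have hπd : HasMFDerivAt IA IB (π F A) (G v₀) dπ := by rw [hGa]; exact hπ.hasMFDerivAt
  have hvel : ∀ e : E a.1, lineVelocity IA a e = T (0, L e) := by
    intro e
    have h1 : HasFDerivAt (fun t : ℝ => v₀ + t • L e)
        ((ContinuousLinearMap.id ℝ ℝ).smulRight (L e)) 0 :=
      ((hasFDerivAt_id (0 : ℝ)).smul_const (L e)).const_add v₀
    have h2 : HasMFDerivAt 𝓘(ℝ, F) IA G (v₀ + (0 : ℝ) • L e)
        (T.comp (ContinuousLinearMap.inr ℝ EB F)) := by
      rw [zero_smul, add_zero]; exact hG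
    have h3 := h2.comp 0 h1.hasMFDerivAt
    have h4 : G ∘ (fun t : ℝ => v₀ + t • L e) = fibreLine a e :=
      funext fun t => (hline e t).symm
    rw [h4] at h3
    have h5 : lineVelocity IA a e = T (0, (1 : ℝ) • L e) :=
      congrArg (fun l : ℝ →L[ℝ] EA => l 1) h3.mfderiv
    rw [h5, one_smul]
  have hRG : ∀ v : F, dR (T (0, v)) = v := by
    intro v
    have h1 := hRd.comp v₀ hG
    have h2 : R ∘ G = id := funext hRH
    rw [h2] at h1
    have h3 := hasMFDerivAt_unique h1 (hasMFDerivAt_id v₀)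
    exact congrArg (fun l : F →L[ℝ] F => l v) h3
  have hπG : ∀ v : F, dπ (T (0, v)) = 0 := by
    intro v
    have h1 := hπd.comp v₀ hG
    have h2 : π F A ∘ G = fun _ => a.1 := funext hH1
    rw [h2] at h1
    have h3 := hasMFDerivAt_unique h1 (hasMFDerivAt_const a.1 v₀)
    exact congrArg (fun l : F →L[ℝ] EB => l v) h3
  have hTR : ∀ w : EA, T (dπ w, dR w) = w := by
    intro w
    have h1 : HasMFDerivAt IA (IB.prod 𝓘(ℝ, F)) (fun b : TotalSpace F A => (b.1, R b)) a
        (dπ.prod dR) := hπ.hasMFDerivAt.prodMk hR.hasMFDerivAt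
    have h2 : HasMFDerivAt (IB.prod 𝓘(ℝ, F)) IA H (a.1, R a) T := by
      rw [hRa]; exact hH.hasMFDerivAt
    have h3 := (h2.comp a h1)
    have h4 := h3.congr_of_eventuallyEq (f₁ := id) (hHR.mono fun b hb => hb.symm)
    have h5 := hasMFDerivAt_unique h4 (hasMFDerivAt_id a)
    exact congrArg (fun l : EA →L[ℝ] EA => l w) h5
  let l : E a.1 →ₗ[ℝ] EA := (T.comp (ContinuousLinearMap.inr ℝ EB F)).toLinearMap ∘ₗ L.toLinearMap
  have hl : ∀ e, l e = T (0, L e) := fun e => rfl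
  refine ⟨l, fun e => (hvel e).symm, ?_, ?_⟩
  · intro e e' h
    have h' : l e = l e' := h
    rw [hl, hl] at h'
    have := congrArg dR h'
    rw [hRG, hRG] at this
    exact L.injective this
  · refine le_antisymm ?_ ?_
    · rintro _ ⟨e, rfl⟩
      exact hπG (L e)
    · intro w hw
      have hw' : dπ w = 0 := hw
      refine ⟨L.symm (dR w), ?_⟩
      have h1 := hTR w
      rw [hw'] at h1
      exact (congrArg (fun v => T (0, v)) (L.apply_symm_apply (dR w))).trans h1

/-- The vertical lift `vl_A(a, ·) : E_x ≅ V_a A`, for `a` in the fibre of `x`: it sends `e` to the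
velocity at `t = 0` of the line `t ↦ a + t e`. -/
def vertLift [ContMDiffVectorBundle ∞ F E IB] [SmoothAffineBundle F E A IB IA]
    (a : TotalSpace F A) : E a.1 ≃ₗ[ℝ] verticalSpace IB IA a :=
  let h := (exists_linear_lineVelocity (E := E) IB IA a).choose_spec
  (LinearEquiv.ofInjective _ h.2.1).trans (LinearEquiv.ofEq _ _ h.2.2)

theorem vertLift_apply [ContMDiffVectorBundle ∞ F E IB] [SmoothAffineBundle F E A IB IA]
    (a : TotalSpace F A) (e : E a.1) :
    (vertLift IB IA a e : TangentSpace IA a) = lineVelocity IA a e :=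
  (exists_linear_lineVelocity (E := E) IB IA a).choose_spec.1 e

end Vertical

/-! ### Fibre derivatives -/

/-- The ordinary derivative, at `p`, of a map between affine spaces over topological vector
spaces, as a continuous linear map between the modelling vector spaces. -/
def affineDeriv {V W P Q : Type*} [AddCommGroup V] [Module ℝ V] [TopologicalSpace V]
    [AddCommGroup W] [Module ℝ W] [TopologicalSpace W] [AddTorsor V P] [AddTorsor W Q]
    (g : P → Q) (p : P) : V →L[ℝ] W :=
  fderiv ℝ (fun v : V => g (v +ᵥ p) -ᵥ g p) 0

section Derivatives

variable {EB HB M EA HA F : Type*} {E A : M → Type*}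
  [NormedAddCommGroup EB] [NormedSpace ℝ EB] [TopologicalSpace HB]
  (IB : ModelWithCorners ℝ EB HB) [TopologicalSpace M] [ChartedSpace HB M]
  [NormedAddCommGroup F] [NormedSpace ℝ F]
  [∀ x, AddCommGroup (E x)] [∀ x, Module ℝ (E x)] [∀ x, TopologicalSpace (E x)]
  [TopologicalSpace (TotalSpace F E)] [FiberBundle F E] [VectorBundle ℝ F E]
  [NormedAddCommGroup EA] [NormedSpace ℝ EA] [TopologicalSpace HA]
  (IA : ModelWithCorners ℝ EA HA)
  [TopologicalSpace (TotalSpace F A)] [ChartedSpace HA (TotalSpace F A)]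
  [∀ x, AddTorsor (E x) (A x)]

variable (F E) in
/-- The total space of the dual bundle `E^* = Hom(E, M × ℝ)`. -/
abbrev DualSpace : Type _ :=
  TotalSpace (F →L[ℝ] ℝ) (fun x : M => E x →L[ℝ] Trivial M ℝ x)

/-- The fibre derivative `𝓕 = D f : A → E^*` of a function `f : A → ℝ`. -/
def fibreDeriv (f : TotalSpace F A → ℝ) (a : TotalSpace F A) : DualSpace F E :=
  ⟨a.1, (affineDeriv (fun b : A a.1 => f ⟨a.1, b⟩) a.2 : E a.1 →L[ℝ] ℝ)⟩

/-- The fibre hessian `D² f = D 𝓕` at `a`. -/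
def fibreHessian (f : TotalSpace F A → ℝ) (a : TotalSpace F A) :
    E a.1 →L[ℝ] (E a.1 →L[ℝ] ℝ) :=
  let g : A a.1 → (E a.1 →L[ℝ] ℝ) := fun b => (fibreDeriv (E := E) f ⟨a.1, b⟩).2
  affineDeriv g a.2

/-- The fibres of a vector bundle of finite rank are finite-dimensional Hausdorff topological
vector spaces. -/
theorem finiteDimensional_fibre (F : Type*) (E : M → Type*)
    [NormedAddCommGroup F] [NormedSpace ℝ F] [FiniteDimensional ℝ F]
    [∀ x, AddCommGroup (E x)] [∀ x, Module ℝ (E x)] [∀ x, TopologicalSpace (E x)]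
    [TopologicalSpace (TotalSpace F E)] [FiberBundle F E] [VectorBundle ℝ F E] (x : M) :
    FiniteDimensional ℝ (E x) ∧ T2Space (E x) ∧ IsTopologicalAddGroup (E x) ∧
      ContinuousSMul ℝ (E x) :=
  let L := (trivializationAt F E x).continuousLinearEquivAt ℝ x
    (mem_baseSet_trivializationAt F E x)
  ⟨L.symm.toLinearEquiv.finiteDimensional, L.toHomeomorph.symm.t2Space,
    L.toHomeomorph.isInducing.topologicalAddGroup L.toLinearMap,
    L.toHomeomorph.isInducing.continuousSMul continuous_id (fun {c v} => L.map_smul c v)⟩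

variable (F E) in
/-- The canonical isomorphism `E_x ≅ E_x^{**}`, which sends `e` to the evaluation `α ↦ α e`. -/
def bidualEquiv [FiniteDimensional ℝ F] (x : M) :
    E x ≃ₗ[ℝ] Module.Dual ℝ (E x →L[ℝ] ℝ) :=
  haveI := (finiteDimensional_fibre F E x).1
  haveI := (finiteDimensional_fibre F E x).2.1
  haveI := (finiteDimensional_fibre F E x).2.2.1
  haveI := (finiteDimensional_fibre F E x).2.2.2
  (Module.evalEquiv ℝ (E x)).trans
    (LinearMap.toContinuousLinearMap (𝕜 := ℝ) (E := E x) (F' := ℝ)).symm.dualMap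

theorem bidualEquiv_apply [FiniteDimensional ℝ F] (x : M) (e : E x) (α : E x →L[ℝ] ℝ) :
    bidualEquiv F E x e α = α e := rfl

/-- For `h : E^* → ℝ`, the map `γ_h = D h ∘ 𝓕 : A → E^{**} ≅ E`. -/
def gammaMap [FiniteDimensional ℝ F] (f : TotalSpace F A → ℝ) (h : DualSpace F E → ℝ)
    (a : TotalSpace F A) : E a.1 :=
  let hx : (E a.1 →L[ℝ] ℝ) → ℝ := fun α => h ⟨a.1, α⟩
  let Dh : (E a.1 →L[ℝ] ℝ) →L[ℝ] ℝ := affineDeriv hx (fibreDeriv f a).2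
  (bidualEquiv F E a.1).symm Dh.toLinearMap

/-- The vertical vector field `Γ_h = vl_A ∘ (Id_A, γ_h)` on `A`. -/
def gammaField [FiniteDimensional ℝ F] [ContMDiffVectorBundle ∞ F E IB]
    [SmoothAffineBundle F E A IB IA] (f : TotalSpace F A → ℝ) (h : DualSpace F E → ℝ)
    (a : TotalSpace F A) : TangentSpace IA a :=
  (vertLift IB IA a (gammaMap f h a) : TangentSpace IA a)

/-- The operator `Ŵ_a : V_a A → V_a^* A` obtained from the fibre hessian of `f` through the
vertical lift: `Ŵ_a (vl e) (vl e') = D² f(a)(e)(e')`. -/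
def hessianOp [ContMDiffVectorBundle ∞ F E IB] [SmoothAffineBundle F E A IB IA]
    (f : TotalSpace F A → ℝ) (a : TotalSpace F A) :
    verticalSpace IB IA a →ₗ[ℝ] Module.Dual ℝ (verticalSpace IB IA a) :=
  (vertLift IB IA a).symm.toLinearMap.dualMap ∘ₗ ContinuousLinearMap.coeLM ℝ ∘ₗ
    (fibreHessian f a).toLinearMap ∘ₗ (vertLift IB IA a).symm.toLinearMap

theorem hessianOp_apply [ContMDiffVectorBundle ∞ F E IB] [SmoothAffineBundle F E A IB IA]
    (f : TotalSpace F A → ℝ) (a : TotalSpace F A) (v w : verticalSpace IB IA a) :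
    hessianOp IB IA f a v w =
      fibreHessian f a ((vertLift IB IA a).symm v) ((vertLift IB IA a).symm w) := rfl

/-- `Ker Ŵ_a`, as a space of tangent vectors of `A` at `a`. -/
def kerHessianOp [ContMDiffVectorBundle ∞ F E IB] [SmoothAffineBundle F E A IB IA]
    (f : TotalSpace F A → ℝ) (a : TotalSpace F A) : Submodule ℝ (TangentSpace IA a) :=
  (LinearMap.ker (hessianOp IB IA f a)).map (verticalSpace IB IA a).subtype

/-- `Ker T_a 𝓕`. -/
def kerTangentFibreDeriv (f : TotalSpace F A → ℝ) (a : TotalSpace F A) :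
    Submodule ℝ (TangentSpace IA a) :=
  LinearMap.ker (mfderiv IA (IB.prod 𝓘(ℝ, F →L[ℝ] ℝ)) (fibreDeriv (E := E) f) a).toLinearMap

end Derivatives

/-! ### Submanifolds, defining functions, frames -/

section Manifolds

variable {EX HX X EY HY Y : Type*}
  [NormedAddCommGroup EX] [NormedSpace ℝ EX] [TopologicalSpace HX]
  (I : ModelWithCorners ℝ EX HX) [TopologicalSpace X] [ChartedSpace HX X]
  [NormedAddCommGroup EY] [NormedSpace ℝ EY] [TopologicalSpace HY]
  (J : ModelWithCorners ℝ EY HY) [TopologicalSpace Y] [ChartedSpace HY Y]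

/-- `g : X → Y` is a submersion onto a closed submanifold: its image is closed, and, with the
topology induced by `Y`, it carries a manifold structure for which the inclusion in `Y` is a
smooth embedding and `g`, as a map onto its image, is a submersion. -/
def IsSubmersionOntoClosedSubmanifold (g : X → Y) : Prop :=
  IsClosed (Set.range g) ∧
    ∃ (d : ℕ) (_ : ChartedSpace (EuclideanSpace ℝ (Fin d)) (Set.range g)),
      IsManifold (𝓡 d) ∞ (Set.range g) ∧
      Manifold.IsSmoothEmbedding (𝓡 d) J ∞ (Subtype.val : Set.range g → Y) ∧
      Manifold.IsSubmersion I (𝓡 d) ∞ (Set.rangeFactorization g)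

/-- The functions `φ μ` define the subset `S` on the open set `U`: they are smooth on `U`,
`S ∩ U` is the set of their common zeros in `U`, and their differentials are linearly independent
at every point of `S ∩ U`. -/
structure DefinesOn {k : ℕ} (φ : Fin k → Y → ℝ) (S U : Set Y) : Prop where
  isOpen : IsOpen U
  contMDiffOn : ∀ μ, ContMDiffOn J 𝓘(ℝ, ℝ) ∞ (φ μ) U
  inter_eq : S ∩ U = {p ∈ U | ∀ μ, φ μ p = 0}
  linearIndependent : ∀ p ∈ S ∩ U, LinearIndependent ℝ fun μ => mvfderiv J (φ μ) p

/-- The vector fields `Γ μ` constitute a frame, on `U`, of the family `K` of subspaces of the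
tangent spaces: they are smooth on `U` and their values at every point of `U` are a basis of the
subspace at that point. -/
structure IsFrameOn [IsManifold I ∞ X] {k : ℕ} (Γ : Fin k → ∀ a : X, TangentSpace I a)
    (K : ∀ a : X, Submodule ℝ (TangentSpace I a)) (U : Set X) : Prop where
  contMDiffOn : ∀ μ, ContMDiffOn I I.tangent ∞ (fun a => (⟨a, Γ μ a⟩ : TangentBundle I X)) U
  linearIndependent : ∀ a ∈ U, LinearIndependent ℝ fun μ => Γ μ a
  span_eq : ∀ a ∈ U, Submodule.span ℝ (Set.range fun μ => Γ μ a) = K a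

end Manifolds

section AlmostRegular

variable {EB HB M EA HA F : Type*} {E A : M → Type*}
  [NormedAddCommGroup EB] [NormedSpace ℝ EB] [TopologicalSpace HB]
  (IB : ModelWithCorners ℝ EB HB) [TopologicalSpace M] [ChartedSpace HB M]
  [NormedAddCommGroup F] [NormedSpace ℝ F]
  [∀ x, AddCommGroup (E x)] [∀ x, Module ℝ (E x)] [∀ x, TopologicalSpace (E x)]
  [TopologicalSpace (TotalSpace F E)] [FiberBundle F E] [VectorBundle ℝ F E]
  [NormedAddCommGroup EA] [NormedSpace ℝ EA] [TopologicalSpace HA]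
  (IA : ModelWithCorners ℝ EA HA)
  [TopologicalSpace (TotalSpace F A)] [ChartedSpace HA (TotalSpace F A)]
  [∀ x, AddTorsor (E x) (A x)]

variable (E) in
/-- `f : A → ℝ` is almost regular: its fibre derivative `𝓕` has connected fibres and is a
submersion onto a closed submanifold of `E^*`. -/
structure AlmostRegular (f : TotalSpace F A → ℝ) : Prop where
  isConnected_fibre : ∀ p ∈ Set.range (fibreDeriv (E := E) f),
    IsConnected (fibreDeriv (E := E) f ⁻¹' {p})
  isSubmersionOnto : IsSubmersionOntoClosedSubmanifold IA (IB.prod 𝓘(ℝ, F →L[ℝ] ℝ))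
    (fibreDeriv (E := E) f)

end AlmostRegular

end FibreDerivative

end

/-!
The vertical lift identifies `Ker Ŵ_a` with `Ker D²f(a)`, and `T_a𝓕` maps `vl e` to the vertical
lift of `D²f(a) e`. Since `𝓕` covers the identity of `M`, every vector of `Ker T_a𝓕` is vertical,
so that both kernels are the vertical lift of `Ker D²f(a)`.

For functions `φ_μ` defining `𝓕(A)` near `𝓕(a)`, the theory of Lagrange multipliers gives
`Im T_a𝓕 = ⋂ Ker dφ_μ`. On vertical vectors this reads `Im D²f(a) = ⋂ Ker γ_μ`, where
`γ_μ = γ_{φ_μ}(a)` is a vector of `E_x ≅ E_x^{**}`. As `D²f(a)` is symmetric, `Ker D²f(a)` is the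
annihilator of its image, that is, the span of the `γ_μ`. Finally, `T_{𝓕(a)}E^*` is the sum of
`Im T_a𝓕`, where all the `dφ_μ` vanish, and of the vertical space, where `dφ_μ` is `γ_μ`; hence a
linear relation between the `γ_μ` is one between the `dφ_μ`.
-/

noncomputable section

namespace FibreDerivative

/-! ### Norms on the fibres of a vector bundle -/

section FibreNorm

variable {M : Type*} (F : Type*) (E : M → Type*) [TopologicalSpace M]
  [NormedAddCommGroup F] [NormedSpace ℝ F]
  [∀ x, AddCommGroup (E x)] [∀ x, Module ℝ (E x)] [∀ x, TopologicalSpace (E x)]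
  [TopologicalSpace (TotalSpace F E)] [FiberBundle F E] [VectorBundle ℝ F E]

/-- The isomorphism of the fibre `E x` with `F` given by the preferred trivialization at `x`. -/
abbrev fibreEquiv (x : M) : E x ≃L[ℝ] F :=
  (trivializationAt F E x).continuousLinearEquivAt ℝ x (mem_baseSet_trivializationAt F E x)

/-- The norm of `E x` carried over from `F`, for the use of differential calculus in the fibre.
Its topology is the given one by definition, so that derivatives such as `affineDeriv`, which only
refer to the topology of `E x`, are derivatives for this norm. -/
abbrev fibreNormedAddCommGroup (x : M) : NormedAddCommGroup (E x) where
  toMetricSpace := (MetricSpace.induced (fibreEquiv F E x) (fibreEquiv F E x).injective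
    inferInstance).replaceTopology (fibreEquiv F E x).toHomeomorph.isInducing.eq_induced
  norm v := ‖fibreEquiv F E x v‖
  dist_eq v w := by
    rw [map_add, map_neg]
    exact dist_eq_norm_neg_add (fibreEquiv F E x v) (fibreEquiv F E x w)

/-- The fibre `E x` as a normed space, for the norm carried over from `F`. -/
abbrev fibreNormedSpace (x : M) :
    letI := fibreNormedAddCommGroup F E x
    NormedSpace ℝ (E x) :=
  letI := fibreNormedAddCommGroup F E x
  { norm_smul_le := fun c v => by
      change ‖fibreEquiv F E x (c • v)‖ ≤ ‖c‖ * ‖fibreEquiv F E x v‖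
      rw [map_smul, norm_smul] }

end FibreNorm

/-! ### Affine trivializations -/

section AffineTrivialization

variable {EB HB M EA HA F : Type*} {E A : M → Type*}
  [NormedAddCommGroup EB] [NormedSpace ℝ EB] [TopologicalSpace HB]
  (IB : ModelWithCorners ℝ EB HB) [TopologicalSpace M] [ChartedSpace HB M]
  [NormedAddCommGroup F] [NormedSpace ℝ F]
  [∀ x, AddCommGroup (E x)] [TopologicalSpace (TotalSpace F E)]
  [NormedAddCommGroup EA] [NormedSpace ℝ EA] [TopologicalSpace HA]
  (IA : ModelWithCorners ℝ EA HA)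
  [TopologicalSpace (TotalSpace F A)] [ChartedSpace HA (TotalSpace F A)]
  [∀ x, AddTorsor (E x) (A x)]

/-- The trivialization `c` of the affine bundle `A` is a diffeomorphism, and it is affine in every
fibre, with the trivialization `e` of `E` as its linear part. -/
structure IsAffineTrivialization (e : Trivialization F (π F E)) (c : Trivialization F (π F A)) :
    Prop where
  baseSet_subset : c.baseSet ⊆ e.baseSet
  contMDiffOn : ContMDiffOn IA (IB.prod 𝓘(ℝ, F)) ∞ c c.source
  contMDiffOn_symm :
    ContMDiffOn (IB.prod 𝓘(ℝ, F)) IA ∞ c.toOpenPartialHomeomorph.symm c.target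
  snd_vadd : ∀ b : TotalSpace F A, b.1 ∈ c.baseSet → ∀ w : E b.1,
    (c ⟨b.1, w +ᵥ b.2⟩).2 = (c b).2 + (e ⟨b.1, w⟩).2

namespace IsAffineTrivialization

variable {IB IA} {e : Trivialization F (π F E)} {c : Trivialization F (π F A)}
  (hc : IsAffineTrivialization IB IA e c)
include hc

theorem symm_add {b : TotalSpace F A} (hb : b.1 ∈ c.baseSet) (w : E b.1) :
    c.toOpenPartialHomeomorph.symm (b.1, (c b).2 + (e ⟨b.1, w⟩).2) = ⟨b.1, w +ᵥ b.2⟩ := by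
  have hb' : (⟨b.1, w +ᵥ b.2⟩ : TotalSpace F A) ∈ c.source := c.mem_source.2 hb
  have hcb : c ⟨b.1, w +ᵥ b.2⟩ = (b.1, (c b).2 + (e ⟨b.1, w⟩).2) :=
    Prod.ext (c.coe_fst hb') (hc.snd_vadd b hb w)
  rw [← hcb]
  exact c.toOpenPartialHomeomorph.left_inv hb'

theorem contMDiffAt {b : TotalSpace F A} (hb : b.1 ∈ c.baseSet) :
    ContMDiffAt IA (IB.prod 𝓘(ℝ, F)) ∞ c b :=
  hc.contMDiffOn.contMDiffAt (c.open_source.mem_nhds (c.mem_source.2 hb))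

theorem contMDiffAt_symm {z : M × F} (hz : z.1 ∈ c.baseSet) :
    ContMDiffAt (IB.prod 𝓘(ℝ, F)) IA ∞ c.toOpenPartialHomeomorph.symm z :=
  hc.contMDiffOn_symm.contMDiffAt (c.open_target.mem_nhds (c.mem_target.2 hz))

end IsAffineTrivialization

/-- The trivialization obtained by composing a trivialization `e` with an isomorphism `Θ` of
bundles over the open set `U` of the base. -/
def trivializationComp {B Z Z' : Type*} [TopologicalSpace B] [TopologicalSpace Z]
    [TopologicalSpace Z'] {proj : Z → B} {proj' : Z' → B} (e : Trivialization F proj)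
    (Θ : OpenPartialHomeomorph Z' Z) {U : Set B} (hU : IsOpen U)
    (hsource : Θ.source = proj' ⁻¹' U) (htarget : Θ.target = proj ⁻¹' U)
    (hproj : ∀ z, proj (Θ z) = proj' z) : Trivialization F proj' where
  toOpenPartialHomeomorph := Θ.trans e.toOpenPartialHomeomorph
  baseSet := U ∩ e.baseSet
  open_baseSet := hU.inter e.open_baseSet
  source_eq := by
    ext z
    simp only [OpenPartialHomeomorph.trans_source, hsource, Set.mem_inter_iff, Set.mem_preimage,
      e.mem_source, hproj]
  target_eq := by
    ext z
    simp only [OpenPartialHomeomorph.trans_target, htarget, Set.mem_inter_iff, Set.mem_preimage,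
      e.mem_target, Set.mem_prod, Set.mem_univ, and_true]
    rw [and_comm]
    exact and_congr_left fun hz => by rw [e.proj_symm_apply (e.mem_target.2 hz)]
  proj_toFun z hz := (e.coe_fst hz.2).trans (hproj z)

variable (F E A) in
theorem exists_isAffineTrivialization [∀ x, Module ℝ (E x)] [∀ x, TopologicalSpace (E x)]
    [FiberBundle F E] [VectorBundle ℝ F E] [ContMDiffVectorBundle ∞ F E IB]
    [SmoothAffineBundle F E A IB IA] (x₀ : M) :
    ∃ c : Trivialization F (π F A), x₀ ∈ c.baseSet ∧
      IsAffineTrivialization IB IA (trivializationAt F E x₀) c := by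
  obtain ⟨U, hU, hxU, s, hΨ, hΘ⟩ :=
    SmoothAffineBundle.exists_section (F := F) (E := E) (A := A) (IB := IB) (IA := IA) x₀
  have hπ : Continuous (π F A) :=
    (SmoothAffineBundle.contMDiff_proj (F := F) (E := E) (A := A) (IB := IB) (IA := IA)).continuous
  let e := trivializationAt F E x₀
  let Θ : OpenPartialHomeomorph (TotalSpace F A) (TotalSpace F E) :=
    { toFun := fun b => ⟨b.1, b.2 -ᵥ s b.1⟩
      invFun := fun v => ⟨v.1, v.2 +ᵥ s v.1⟩
      source := π F A ⁻¹' U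
      target := π F E ⁻¹' U
      map_source' := fun _ hb => hb
      map_target' := fun _ hv => hv
      left_inv' := fun b _ => by simp
      right_inv' := fun v _ => by simp
      open_source := hU.preimage hπ
      open_target := hU.preimage (FiberBundle.continuous_proj F E)
      continuousOn_toFun := hΘ.continuousOn
      continuousOn_invFun := hΨ.continuousOn }
  refine ⟨trivializationComp e Θ hU rfl rfl fun _ => rfl,
    ⟨hxU, mem_baseSet_trivializationAt F E x₀⟩, Set.inter_subset_right, ?_, ?_, ?_⟩
  · exact e.contMDiffOn.comp (hΘ.mono fun b hb => hb.1) fun b hb => hb.2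
  · exact hΨ.comp (e.contMDiffOn_symm.mono fun z hz => hz.1) fun z hz => hz.2
  · intro b hb w
    have hΘ_vadd : Θ ⟨b.1, w +ᵥ b.2⟩ = ⟨b.1, (b.2 -ᵥ s b.1) + w⟩ := by
      simp [Θ, vadd_vsub_assoc, add_comm]
    change (e (Θ _)).2 = _
    rw [hΘ_vadd]
    exact (e.linear ℝ hb.2).map_add _ _

end AffineTrivialization

section VectorBundle

variable {EB HB M F : Type*} {E : M → Type*}
  [NormedAddCommGroup EB] [NormedSpace ℝ EB] [TopologicalSpace HB]
  {IB : ModelWithCorners ℝ EB HB} [TopologicalSpace M] [ChartedSpace HB M]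
  [NormedAddCommGroup F] [NormedSpace ℝ F]
  [∀ x, AddCommGroup (E x)] [∀ x, Module ℝ (E x)] [∀ x, TopologicalSpace (E x)]
  [TopologicalSpace (TotalSpace F E)] [FiberBundle F E]

instance smoothAffineBundle_self : SmoothAffineBundle F E E IB (IB.prod 𝓘(ℝ, F)) where
  contMDiff_proj := contMDiff_proj E
  exists_section x := ⟨Set.univ, isOpen_univ, Set.mem_univ x, fun _ => 0,
    contMDiffOn_id.congr fun v _ => by simp, contMDiffOn_id.congr fun v _ => by simp⟩

end VectorBundle

/-! ### Differential calculus along the fibres -/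

section FibreInclusion

variable {M F : Type*} {E A : M → Type*}

/-- The inclusion in `A` of the fibre through `a`, as the map `v ↦ a + v` from `E_x`. -/
def fibreInclusion [∀ x, AddCommGroup (E x)] [∀ x, AddTorsor (E x) (A x)] (a : TotalSpace F A)
    (v : E a.1) : TotalSpace F A :=
  ⟨a.1, v +ᵥ a.2⟩

theorem fibreInclusion_zero [∀ x, AddCommGroup (E x)] [∀ x, AddTorsor (E x) (A x)]
    (a : TotalSpace F A) : fibreInclusion (E := E) a 0 = a := by
  simp [fibreInclusion]

variable [NormedAddCommGroup F] [NormedSpace ℝ F] [∀ x, NormedAddCommGroup (E x)]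
  [∀ x, NormedSpace ℝ (E x)] [∀ x, AddTorsor (E x) (A x)]

theorem snd_fibreDeriv_eq_fderiv (f : TotalSpace F A → ℝ) (a : TotalSpace F A) :
    (fibreDeriv (E := E) f a).2 = fderiv ℝ (f ∘ fibreInclusion (E := E) a) 0 :=
  fderiv_sub_const (f := f ∘ fibreInclusion (E := E) a) (f a)

theorem snd_fibreDeriv_fibreInclusion (f : TotalSpace F A → ℝ) (a : TotalSpace F A) (v : E a.1) :
    (fibreDeriv (E := E) f (fibreInclusion a v)).2 =
      fderiv ℝ (f ∘ fibreInclusion (E := E) a) v := by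
  have h : f ∘ fibreInclusion (E := E) (fibreInclusion a v) =
      fun w => (f ∘ fibreInclusion (E := E) a) (w + v) := by
    ext1 w
    exact congrArg (fun p => f ⟨a.1, p⟩) (add_vadd (G := E a.1) w v a.2).symm
  have hv := fderiv_comp_add_right (𝕜 := ℝ) (f := f ∘ fibreInclusion (E := E) a) (x := 0) v
  rw [zero_add] at hv
  rw [snd_fibreDeriv_eq_fderiv, h, ← hv]
  rfl

theorem fibreHessian_eq_fderiv (f : TotalSpace F A → ℝ) (a : TotalSpace F A) :
    fibreHessian (E := E) f a = fderiv ℝ (fderiv ℝ (f ∘ fibreInclusion (E := E) a)) 0 := by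
  have h : fderiv ℝ (f ∘ fibreInclusion (E := E) a) =
      fun v => (fibreDeriv (E := E) f (fibreInclusion a v)).2 :=
    funext fun v => (snd_fibreDeriv_fibreInclusion f a v).symm
  rw [h]
  exact fderiv_sub_const _

end FibreInclusion

section Translations

variable {EB HB M EA HA F EN HN N : Type*} {E A : M → Type*}
  [NormedAddCommGroup EB] [NormedSpace ℝ EB] [TopologicalSpace HB]
  {IB : ModelWithCorners ℝ EB HB} [TopologicalSpace M] [ChartedSpace HB M]
  [NormedAddCommGroup F] [NormedSpace ℝ F]
  [NormedAddCommGroup EA] [NormedSpace ℝ EA] [TopologicalSpace HA]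
  {IA : ModelWithCorners ℝ EA HA}
  [TopologicalSpace (TotalSpace F A)] [ChartedSpace HA (TotalSpace F A)]
  [NormedAddCommGroup EN] [NormedSpace ℝ EN] [TopologicalSpace HN]
  {I : ModelWithCorners ℝ EN HN} [TopologicalSpace N] [ChartedSpace HN N]

theorem contMDiffAt_equiv_comp_iff {V W : Type*} [NormedAddCommGroup V] [NormedSpace ℝ V]
    [NormedAddCommGroup W] [NormedSpace ℝ W] {L : V ≃L[ℝ] W} {w : N → V} {n : N} :
    ContMDiffAt I 𝓘(ℝ, W) ∞ (fun m => L (w m)) n ↔ ContMDiffAt I 𝓘(ℝ, V) ∞ w n := by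
  refine ⟨fun h => ?_, fun h => L.contDiff.contMDiff.contMDiffAt.comp n h⟩
  simpa [Function.comp_def] using L.symm.contDiff.contMDiff.contMDiffAt.comp n h

section Sums

variable [∀ x, AddCommGroup (E x)] [∀ x, Module ℝ (E x)] [∀ x, TopologicalSpace (E x)]
  [TopologicalSpace (TotalSpace F E)] [FiberBundle F E] [VectorBundle ℝ F E]
  [ContMDiffVectorBundle ∞ F E IB] [∀ x, AddTorsor (E x) (A x)] [SmoothAffineBundle F E A IB IA]

variable (IB) in
theorem contMDiffAt_vadd {b : N → TotalSpace F A} {w : ∀ n, E (b n).1} {n : N}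
    (hb : ContMDiffAt I IA ∞ b n)
    (hw : ContMDiffAt I (IB.prod 𝓘(ℝ, F)) ∞ (fun m => (⟨(b m).1, w m⟩ : TotalSpace F E)) n) :
    ContMDiffAt I IA ∞ (fun m => (⟨(b m).1, w m +ᵥ (b m).2⟩ : TotalSpace F A)) n := by
  obtain ⟨c, hnc, hc⟩ := exists_isAffineTrivialization F E A IB IA (b n).1
  have hproj : ContMDiffAt I IB ∞ (fun m => (b m).1) n :=
    (SmoothAffineBundle.contMDiff_proj (F := F) (E := E) (A := A) (IB := IB)
      (IA := IA)).contMDiffAt.comp n hb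
  have hcoord : ContMDiffAt I (IB.prod 𝓘(ℝ, F)) ∞ (fun m => ((b m).1,
      (c (b m)).2 + (trivializationAt F E (b n).1 ⟨(b m).1, w m⟩).2)) n :=
    hproj.prodMk ((contMDiffAt_snd.comp n ((hc.contMDiffAt hnc).comp n hb)).add
      (contMDiffAt_totalSpace.1 hw).2)
  refine ((hc.contMDiffAt_symm hnc).comp n hcoord).congr_of_eventuallyEq ?_
  filter_upwards [hproj.continuousAt (c.open_baseSet.mem_nhds hnc)] with m hm
  exact (hc.symm_add hm (w m)).symm

end Sums

variable [∀ x, NormedAddCommGroup (E x)] [∀ x, NormedSpace ℝ (E x)]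
  [TopologicalSpace (TotalSpace F E)] [FiberBundle F E] [VectorBundle ℝ F E]

theorem contMDiffAt_totalSpaceMk_iff [ContMDiffVectorBundle ∞ F E IB] {x : M} {w : N → E x}
    {n : N} :
    ContMDiffAt I (IB.prod 𝓘(ℝ, F)) ∞ (fun m => (⟨x, w m⟩ : TotalSpace F E)) n ↔
      ContMDiffAt I 𝓘(ℝ, E x) ∞ w n := by
  rw [contMDiffAt_totalSpace]
  have hL (m : N) : (trivializationAt F E x ⟨x, w m⟩).2 = fibreEquiv F E x (w m) := rfl
  simp only [hL]
  exact ⟨fun h => contMDiffAt_equiv_comp_iff.1 h.2, fun h =>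
    ⟨contMDiffAt_const, contMDiffAt_equiv_comp_iff.2 h⟩⟩

variable [∀ x, AddTorsor (E x) (A x)]

theorem contMDiffAt_vsub_of_totalSpaceMk [ContMDiffVectorBundle ∞ F E IB]
    [SmoothAffineBundle F E A IB IA] {x : M} {g : N → A x} {n : N}
    (hg : ContMDiffAt I IA ∞ (fun m => (⟨x, g m⟩ : TotalSpace F A)) n) (p : A x) :
    ContMDiffAt I 𝓘(ℝ, E x) ∞ (fun m => g m -ᵥ p) n := by
  obtain ⟨c, hx, hc⟩ := exists_isAffineTrivialization F E A IB IA x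
  have hcoord : ContMDiffAt I 𝓘(ℝ, F) ∞ (fun m => (c ⟨x, g m⟩).2 - (c ⟨x, p⟩).2) n :=
    (contMDiffAt_snd.comp n ((hc.contMDiffAt (b := ⟨x, g n⟩) hx).comp n hg)).sub contMDiffAt_const
  have hdiff (m : N) : (c ⟨x, g m⟩).2 - (c ⟨x, p⟩).2 = fibreEquiv F E x (g m -ᵥ p) := by
    have h := hc.snd_vadd ⟨x, p⟩ hx (g m -ᵥ p)
    rw [vsub_vadd] at h
    rw [h, add_sub_cancel_left]
    rfl
  simp only [hdiff] at hcoord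
  exact contMDiffAt_equiv_comp_iff.1 hcoord

theorem contMDiff_fibreInclusion [ContMDiffVectorBundle ∞ F E IB] [SmoothAffineBundle F E A IB IA]
    (a : TotalSpace F A) : ContMDiff 𝓘(ℝ, E a.1) IA ∞ (fibreInclusion (E := E) a) := fun _ =>
  contMDiffAt_vadd IB contMDiffAt_const (contMDiffAt_totalSpaceMk_iff.2 contMDiffAt_id)

variable (IB IA) in
theorem mfderiv_fibreInclusion_zero [ContMDiffVectorBundle ∞ F E IB]
    [SmoothAffineBundle F E A IB IA] (a : TotalSpace F A) (e : E a.1) :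
    mfderiv 𝓘(ℝ, E a.1) IA (fibreInclusion (E := E) a) 0 e = lineVelocity IA a e := by
  have hincl : HasMFDerivAt 𝓘(ℝ, E a.1) IA (fibreInclusion (E := E) a) ((0 : ℝ) • e)
      (mfderiv 𝓘(ℝ, E a.1) IA (fibreInclusion (E := E) a) 0) := by
    rw [zero_smul]
    exact ((contMDiff_fibreInclusion (IB := IB) a).mdifferentiableAt (by simp)).hasMFDerivAt
  have hline : HasMFDerivAt 𝓘(ℝ, ℝ) 𝓘(ℝ, E a.1) (fun t : ℝ => t • e) 0
      (ContinuousLinearMap.toSpanSingleton ℝ e) :=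
    (ContinuousLinearMap.toSpanSingleton ℝ e).hasMFDerivAt
  have h := congrArg (fun l => l (1 : ℝ)) (hincl.comp (0 : ℝ) hline).mfderiv
  refine Eq.trans ?_ h.symm
  exact congrArg _ (one_smul ℝ e).symm

end Translations

section FibreDerivatives

variable {EB HB M EA HA EA' HA' F F' : Type*} {E A E' A' : M → Type*}
  [NormedAddCommGroup EB] [NormedSpace ℝ EB] [TopologicalSpace HB]
  {IB : ModelWithCorners ℝ EB HB} [TopologicalSpace M] [ChartedSpace HB M]
  [NormedAddCommGroup F] [NormedSpace ℝ F]
  [∀ x, AddCommGroup (E x)] [∀ x, Module ℝ (E x)] [∀ x, TopologicalSpace (E x)]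
  [TopologicalSpace (TotalSpace F E)] [FiberBundle F E] [VectorBundle ℝ F E]
  [NormedAddCommGroup EA] [NormedSpace ℝ EA] [TopologicalSpace HA]
  {IA : ModelWithCorners ℝ EA HA}
  [TopologicalSpace (TotalSpace F A)] [ChartedSpace HA (TotalSpace F A)]
  [∀ x, AddTorsor (E x) (A x)]

variable (IB) in
theorem mvfderiv_lineVelocity [ContMDiffVectorBundle ∞ F E IB] [SmoothAffineBundle F E A IB IA]
    {f : TotalSpace F A → ℝ} {a : TotalSpace F A} (hf : MDifferentiableAt IA 𝓘(ℝ, ℝ) f a)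
    (e : E a.1) :
    mvfderiv IA f a (lineVelocity IA a e) = (fibreDeriv (E := E) f a).2 e := by
  let := fibreNormedAddCommGroup F E
  let := fibreNormedSpace F E
  have hincl : MDifferentiableAt 𝓘(ℝ, E a.1) IA (fibreInclusion (E := E) a) 0 :=
    (contMDiff_fibreInclusion (IB := IB) a).mdifferentiableAt (by simp)
  rw [snd_fibreDeriv_eq_fderiv, ← mfderiv_fibreInclusion_zero IB IA a e, ← mfderiv_eq_fderiv]
  exact (mvfderiv_comp_apply_of_eq _ hf hincl (fibreInclusion_zero a) e).symm

variable (IB) in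
theorem fibreHessian_symm [ContMDiffVectorBundle ∞ F E IB] [SmoothAffineBundle F E A IB IA]
    {f : TotalSpace F A → ℝ} {a : TotalSpace F A} (hf : ContMDiffAt IA 𝓘(ℝ, ℝ) ∞ f a)
    (e e' : E a.1) : fibreHessian f a e e' = fibreHessian f a e' e := by
  let := fibreNormedAddCommGroup F E
  let := fibreNormedSpace F E
  have hcomp : ContDiffAt ℝ ∞ (f ∘ fibreInclusion (E := E) a) 0 :=
    (hf.comp_of_eq (contMDiff_fibreInclusion (IB := IB) a).contMDiffAt
      (fibreInclusion_zero a)).contDiffAt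
  rw [fibreHessian_eq_fderiv]
  refine hcomp.isSymmSndFDerivAt ?_ e e'
  rw [minSmoothness_of_isRCLikeNormedField]
  exact WithTop.coe_le_coe.2 le_top

variable [NormedAddCommGroup F'] [NormedSpace ℝ F']
  [∀ x, AddCommGroup (E' x)] [∀ x, Module ℝ (E' x)] [∀ x, TopologicalSpace (E' x)]
  [TopologicalSpace (TotalSpace F' E')] [FiberBundle F' E'] [VectorBundle ℝ F' E']
  [NormedAddCommGroup EA'] [NormedSpace ℝ EA'] [TopologicalSpace HA']
  {IA' : ModelWithCorners ℝ EA' HA'}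
  [TopologicalSpace (TotalSpace F' A')] [ChartedSpace HA' (TotalSpace F' A')]
  [∀ x, AddTorsor (E' x) (A' x)]

variable (IB) in
theorem mfderiv_lineVelocity [ContMDiffVectorBundle ∞ F E IB] [SmoothAffineBundle F E A IB IA]
    [ContMDiffVectorBundle ∞ F' E' IB] [SmoothAffineBundle F' E' A' IB IA']
    {Φ : ∀ x, A x → A' x} {a : TotalSpace F A}
    (hΦ : ContMDiffAt IA IA' ∞
      (fun b : TotalSpace F A => (⟨b.1, Φ b.1 b.2⟩ : TotalSpace F' A')) a) (e : E a.1) :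
    mfderiv IA IA' (fun b : TotalSpace F A => (⟨b.1, Φ b.1 b.2⟩ : TotalSpace F' A')) a
        (lineVelocity IA a e) =
      lineVelocity IA' (⟨a.1, Φ a.1 a.2⟩ : TotalSpace F' A') (affineDeriv (Φ a.1) a.2 e) := by
  let := fibreNormedAddCommGroup F E
  let := fibreNormedSpace F E
  let := fibreNormedAddCommGroup F' E'
  let := fibreNormedSpace F' E'
  set Ψ : TotalSpace F A → TotalSpace F' A' := fun b => ⟨b.1, Φ b.1 b.2⟩
  let g : E a.1 → E' a.1 := fun v => Φ a.1 (v +ᵥ a.2) -ᵥ Φ a.1 a.2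
  have hincl : ContMDiffAt 𝓘(ℝ, E a.1) IA ∞ (fibreInclusion (E := E) a) 0 :=
    (contMDiff_fibreInclusion (IB := IB) a).contMDiffAt
  have hincl' : ContMDiffAt 𝓘(ℝ, E' a.1) IA' ∞ (fibreInclusion (E := E') (Ψ a)) 0 :=
    (contMDiff_fibreInclusion (IB := IB) (Ψ a)).contMDiffAt
  have hcomp : ContMDiffAt 𝓘(ℝ, E a.1) IA' ∞ (Ψ ∘ fibreInclusion (E := E) a) 0 :=
    hΦ.comp_of_eq hincl (fibreInclusion_zero a)
  have hg : ContMDiffAt 𝓘(ℝ, E a.1) 𝓘(ℝ, E' a.1) ∞ g 0 :=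
    contMDiffAt_vsub_of_totalSpaceMk (IB := IB) hcomp (Φ a.1 a.2)
  have hg0 : g 0 = 0 := by simp [g]
  have hΨg : Ψ ∘ fibreInclusion (E := E) a = fibreInclusion (E := E') (Ψ a) ∘ g := by
    ext1 v
    simp [Ψ, g, fibreInclusion]
  have h := mfderiv_comp_apply_of_eq _ (hΦ.mdifferentiableAt (by simp))
    (hincl.mdifferentiableAt (by simp)) (fibreInclusion_zero a) e
  have h' := mfderiv_comp_apply_of_eq _ (hincl'.mdifferentiableAt (by simp))
    (hg.mdifferentiableAt (by simp)) hg0 e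
  rw [← mfderiv_fibreInclusion_zero IB IA]
  refine h.symm.trans ?_
  rw [hΨg]
  refine h'.trans ?_
  rw [mfderiv_eq_fderiv]
  exact mfderiv_fibreInclusion_zero IB IA' (Ψ a) _

end FibreDerivatives

theorem contMDiffAt_fderiv_snd {EB HB M G G' : Type*}
    [NormedAddCommGroup EB] [NormedSpace ℝ EB] [TopologicalSpace HB]
    {IB : ModelWithCorners ℝ EB HB} [TopologicalSpace M] [ChartedSpace HB M] [IsManifold IB ∞ M]
    [NormedAddCommGroup G] [NormedSpace ℝ G] [NormedAddCommGroup G'] [NormedSpace ℝ G']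
    {h : M × G → G'} {z : M × G} (hh : ContMDiffAt (IB.prod 𝓘(ℝ, G)) 𝓘(ℝ, G') ∞ h z) :
    ContMDiffAt (IB.prod 𝓘(ℝ, G)) 𝓘(ℝ, G →L[ℝ] G') ∞
      (fun y : M × G => fderiv ℝ (fun w => h (y.1, w)) y.2) z := by
  have hcurry : ContMDiffAt ((IB.prod 𝓘(ℝ, G)).prod 𝓘(ℝ, G)) 𝓘(ℝ, G') ∞
      (Function.uncurry fun (y : M × G) (w : G) => h (y.1, w)) (z, z.2) :=
    ContMDiffAt.comp (z, z.2) (g := h) hh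
      ((contMDiffAt_fst.comp _ contMDiffAt_fst).prodMk contMDiffAt_snd)
  simpa only [inTangentCoordinates_model_space, mfderiv_eq_fderiv] using
    hcurry.mfderiv (fun (y : M × G) (w : G) => h (y.1, w)) Prod.snd contMDiffAt_snd (m := ∞)
      (by simp)

section SmoothFibreDeriv

variable {EB HB M EA HA F : Type*} {E A : M → Type*}
  [NormedAddCommGroup EB] [NormedSpace ℝ EB] [TopologicalSpace HB]
  {IB : ModelWithCorners ℝ EB HB} [TopologicalSpace M] [ChartedSpace HB M]
  [NormedAddCommGroup F] [NormedSpace ℝ F]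
  [∀ x, AddCommGroup (E x)] [∀ x, Module ℝ (E x)] [∀ x, TopologicalSpace (E x)]
  [TopologicalSpace (TotalSpace F E)] [FiberBundle F E] [VectorBundle ℝ F E]
  [NormedAddCommGroup EA] [NormedSpace ℝ EA] [TopologicalSpace HA]
  {IA : ModelWithCorners ℝ EA HA}
  [∀ x, AddTorsor (E x) (A x)]

theorem apply_gammaMap [FiniteDimensional ℝ F] (f : TotalSpace F A → ℝ) (h : DualSpace F E → ℝ)
    (a : TotalSpace F A) (α : E a.1 →L[ℝ] ℝ) :
    α (gammaMap f h a) =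
      (fibreDeriv (E := fun x => E x →L[ℝ] Trivial M ℝ x) h (fibreDeriv f a)).2 α := by
  rw [← bidualEquiv_apply (F := F), gammaMap, LinearEquiv.apply_symm_apply]
  rfl

variable [TopologicalSpace (TotalSpace F A)] [ChartedSpace HA (TotalSpace F A)]

theorem snd_trivializationAt_dual_apply {x₀ x : M} (hx : x ∈ (trivializationAt F E x₀).baseSet)
    (α : E x →L[ℝ] ℝ) (v : E x) :
    (trivializationAt (F →L[ℝ] ℝ) (fun x : M => E x →L[ℝ] Trivial M ℝ x) x₀ ⟨x, α⟩).2
      (trivializationAt F E x₀ ⟨x, v⟩).2 = α v := by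
  have h : (trivializationAt (F →L[ℝ] ℝ) (fun x : M => E x →L[ℝ] Trivial M ℝ x) x₀ ⟨x, α⟩).2 =
      α ∘L ((trivializationAt F E x₀).continuousLinearEquivAt ℝ x hx).symm := by
    rw [hom_trivializationAt_apply (RingHom.id ℝ) x₀ (⟨x, α⟩ : DualSpace F E)]
    exact ContinuousLinearMap.inCoordinates_eq (σ := RingHom.id ℝ) (F' := ℝ) (E' := Trivial M ℝ)
      (y₀ := x₀) (y := x) hx trivial
  rw [h]
  exact congrArg α
    (((trivializationAt F E x₀).continuousLinearEquivAt ℝ x hx).symm_apply_apply v)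

theorem IsAffineTrivialization.snd_trivializationAt_fibreDeriv {x₀ : M}
    {c : Trivialization F (π F A)} (hc : IsAffineTrivialization IB IA (trivializationAt F E x₀) c)
    (f : TotalSpace F A → ℝ) {b : TotalSpace F A} (hb : b.1 ∈ c.baseSet) :
    (trivializationAt (F →L[ℝ] ℝ) (fun x : M => E x →L[ℝ] Trivial M ℝ x) x₀ (fibreDeriv f b)).2 =
      fderiv ℝ (fun v => f (c.toOpenPartialHomeomorph.symm (b.1, v))) (c b).2 := by
  let := fibreNormedAddCommGroup F E
  let := fibreNormedSpace F E
  let L : E b.1 ≃L[ℝ] F :=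
    (trivializationAt F E x₀).continuousLinearEquivAt ℝ b.1 (hc.baseSet_subset hb)
  let k : F → ℝ := fun v => f (c.toOpenPartialHomeomorph.symm (b.1, v))
  have hfk : f ∘ fibreInclusion (E := E) b = (fun v => k ((c b).2 + v)) ∘ L :=
    funext fun w => congrArg f (hc.symm_add hb w).symm
  have hk : fderiv ℝ (f ∘ fibreInclusion (E := E) b) 0 = fderiv ℝ k (c b).2 ∘L L := by
    rw [hfk, L.comp_right_fderiv, map_zero, fderiv_comp_add_left, add_zero]
  ext u
  obtain ⟨w, rfl⟩ := L.surjective u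
  refine (snd_trivializationAt_dual_apply (hc.baseSet_subset hb) (fibreDeriv f b).2 w).trans ?_
  rw [snd_fibreDeriv_eq_fderiv, hk]
  rfl

theorem contMDiffAt_fibreDeriv [IsManifold IB ∞ M] [ContMDiffVectorBundle ∞ F E IB]
    [SmoothAffineBundle F E A IB IA] {f : TotalSpace F A → ℝ} {a : TotalSpace F A}
    (hf : ContMDiffAt IA 𝓘(ℝ, ℝ) ∞ f a) :
    ContMDiffAt IA (IB.prod 𝓘(ℝ, F →L[ℝ] ℝ)) ∞ (fibreDeriv (E := E) f) a := by
  obtain ⟨c, ha, hc⟩ := exists_isAffineTrivialization F E A IB IA a.1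
  have hproj : ContMDiffAt IA IB ∞ (π F A) a :=
    (SmoothAffineBundle.contMDiff_proj (F := F) (E := E) (A := A)).contMDiffAt
  have hca : c.toOpenPartialHomeomorph.symm (c a) = a :=
    c.toOpenPartialHomeomorph.left_inv (c.mem_source.2 ha)
  have hca_fst : (c a).1 = a.1 := c.coe_fst (c.mem_source.2 ha)
  have hread : ContMDiffAt (IB.prod 𝓘(ℝ, F)) 𝓘(ℝ, ℝ) ∞
      (f ∘ c.toOpenPartialHomeomorph.symm) (c a) :=
    hf.comp_of_eq (hc.contMDiffAt_symm (hca_fst ▸ ha)) hca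
  refine contMDiffAt_totalSpace.2 ⟨hproj, ?_⟩
  refine ((contMDiffAt_fderiv_snd hread).comp a (hc.contMDiffAt ha)).congr_of_eventuallyEq ?_
  filter_upwards [c.open_source.mem_nhds (c.mem_source.2 ha)] with b hb
  rw [show (fibreDeriv (E := E) f a).1 = a.1 from rfl,
    hc.snd_trivializationAt_fibreDeriv f (c.mem_source.1 hb), Function.comp_apply, c.coe_fst hb]
  rfl

variable (F) in
/-- The canonical isomorphism of `F` with its topological bidual. -/
def topBidualEquiv [FiniteDimensional ℝ F] : F ≃L[ℝ] ((F →L[ℝ] ℝ) →L[ℝ] ℝ) :=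
  ((Module.evalEquiv ℝ F).trans
    ((LinearMap.toContinuousLinearMap (𝕜 := ℝ) (E := F) (F' := ℝ)).symm.dualMap.trans
      LinearMap.toContinuousLinearMap)).toContinuousLinearEquiv

theorem contMDiffAt_gammaMap [FiniteDimensional ℝ F] [IsManifold IB ∞ M]
    [ContMDiffVectorBundle ∞ F E IB] [SmoothAffineBundle F E A IB IA] {f : TotalSpace F A → ℝ}
    {h : DualSpace F E → ℝ} {a : TotalSpace F A} (hf : ContMDiffAt IA 𝓘(ℝ, ℝ) ∞ f a)
    (hh : ContMDiffAt (IB.prod 𝓘(ℝ, F →L[ℝ] ℝ)) 𝓘(ℝ, ℝ) ∞ h (fibreDeriv f a)) :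
    ContMDiffAt IA (IB.prod 𝓘(ℝ, F)) ∞
      (fun b => (⟨b.1, gammaMap f h b⟩ : TotalSpace F E)) a := by
  have hDh : ContMDiffAt IA (IB.prod 𝓘(ℝ, (F →L[ℝ] ℝ) →L[ℝ] ℝ)) ∞
      (fun b => fibreDeriv (E := fun x => E x →L[ℝ] Trivial M ℝ x) h (fibreDeriv f b)) a :=
    (contMDiffAt_fibreDeriv (E := fun x => E x →L[ℝ] Trivial M ℝ x) hh).comp a
      (contMDiffAt_fibreDeriv hf)
  obtain ⟨hproj, hsnd⟩ := contMDiffAt_totalSpace.1 hDh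
  have hcoord : ContMDiffAt IA 𝓘(ℝ, (F →L[ℝ] ℝ) →L[ℝ] ℝ) ∞ (fun b =>
      topBidualEquiv F (trivializationAt F E a.1 ⟨b.1, gammaMap f h b⟩).2) a := by
    refine hsnd.congr_of_eventuallyEq ?_
    filter_upwards [hproj.continuousAt ((trivializationAt F E a.1).open_baseSet.mem_nhds
      (mem_baseSet_trivializationAt F E a.1))] with b hb
    have hb' : b.1 ∈ (trivializationAt (F →L[ℝ] ℝ) (fun x : M => E x →L[ℝ] Trivial M ℝ x)
        a.1).baseSet := ⟨hb, trivial⟩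
    ext β
    obtain ⟨α, rfl⟩ := (Trivialization.continuousLinearEquivAt ℝ _ b.1 hb').surjective β
    calc topBidualEquiv F (trivializationAt F E a.1 ⟨b.1, gammaMap f h b⟩).2 _
        = α (gammaMap f h b) := snd_trivializationAt_dual_apply hb α (gammaMap f h b)
      _ = (fibreDeriv (E := fun x => E x →L[ℝ] Trivial M ℝ x) h (fibreDeriv f b)).2 α :=
        apply_gammaMap f h b α
      _ = _ := (snd_trivializationAt_dual_apply hb' _ α).symm
  exact contMDiffAt_totalSpace.2 ⟨hproj, contMDiffAt_equiv_comp_iff.1 hcoord⟩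

end SmoothFibreDeriv

section TangentFibreDeriv

variable {EB HB M EA HA F : Type*} {E A : M → Type*}
  [NormedAddCommGroup EB] [NormedSpace ℝ EB] [TopologicalSpace HB]
  {IB : ModelWithCorners ℝ EB HB} [TopologicalSpace M] [ChartedSpace HB M]
  [NormedAddCommGroup F] [NormedSpace ℝ F]
  [∀ x, AddCommGroup (E x)] [∀ x, Module ℝ (E x)] [∀ x, TopologicalSpace (E x)]
  [TopologicalSpace (TotalSpace F E)] [FiberBundle F E] [VectorBundle ℝ F E]
  [NormedAddCommGroup EA] [NormedSpace ℝ EA] [TopologicalSpace HA]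
  {IA : ModelWithCorners ℝ EA HA} [∀ x, AddTorsor (E x) (A x)]

theorem contMDiffAt_smul_totalSpace {EN HN N : Type*} [NormedAddCommGroup EN] [NormedSpace ℝ EN]
    [TopologicalSpace HN] {I : ModelWithCorners ℝ EN HN} [TopologicalSpace N] [ChartedSpace HN N]
    {t : N → ℝ} {w : N → TotalSpace F E} {n : N} (ht : ContMDiffAt I 𝓘(ℝ, ℝ) ∞ t n)
    (hw : ContMDiffAt I (IB.prod 𝓘(ℝ, F)) ∞ w n) :
    ContMDiffAt I (IB.prod 𝓘(ℝ, F)) ∞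
      (fun m => (⟨(w m).1, t m • (w m).2⟩ : TotalSpace F E)) n := by
  obtain ⟨hproj, hsnd⟩ := contMDiffAt_totalSpace.1 hw
  refine contMDiffAt_totalSpace.2 ⟨hproj, (ht.smul hsnd).congr_of_eventuallyEq ?_⟩
  filter_upwards [hproj.continuousAt ((trivializationAt F E (w n).1).open_baseSet.mem_nhds
    (mem_baseSet_trivializationAt F E (w n).1))] with m hm
  exact ((trivializationAt F E (w n).1).linear ℝ hm).map_smul (t m) (w m).2

variable [TopologicalSpace (TotalSpace F A)] [ChartedSpace HA (TotalSpace F A)]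

variable (IB) in
theorem contMDiffAt_lineVelocity [IsManifold IA ∞ (TotalSpace F A)]
    [ContMDiffVectorBundle ∞ F E IB] [SmoothAffineBundle F E A IB IA]
    {w : ∀ b : TotalSpace F A, E b.1} {a : TotalSpace F A}
    (hw : ContMDiffAt IA (IB.prod 𝓘(ℝ, F)) ∞ (fun b => (⟨b.1, w b⟩ : TotalSpace F E)) a) :
    ContMDiffAt IA IA.tangent ∞
      (fun b => (⟨b, lineVelocity IA b (w b)⟩ : TangentBundle IA (TotalSpace F A))) a := by
  let Φ : TotalSpace F A → ℝ → TotalSpace F A := fun b => fibreLine b (w b)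
  have hΦ0 (b : TotalSpace F A) : Φ b 0 = b := by simp [Φ, fibreLine]
  have hΦ : ContMDiffAt (IA.prod 𝓘(ℝ, ℝ)) IA ∞ (Function.uncurry Φ) (a, 0) :=
    contMDiffAt_vadd IB contMDiffAt_fst (contMDiffAt_smul_totalSpace contMDiffAt_snd
      (ContMDiffAt.comp (a, (0 : ℝ)) (f := Prod.fst) hw contMDiffAt_fst))
  have hΦ0_smooth : ContMDiffAt IA IA ∞ (fun b => Φ b 0) a :=
    contMDiffAt_id.congr_of_eventuallyEq (.of_forall hΦ0)
  have h := ContMDiffAt.clm_apply_of_inCoordinates (IM := IA) (IB₁ := 𝓘(ℝ, ℝ)) (IB₂ := IA)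
    (b₁ := fun _ : TotalSpace F A => (0 : ℝ)) (b₂ := fun b => Φ b 0)
    (E₁ := TangentSpace 𝓘(ℝ, ℝ)) (E₂ := TangentSpace IA)
    (ϕ := fun b => mfderiv 𝓘(ℝ, ℝ) IA (Φ b) 0) (v := fun _ => (1 : ℝ))
    (hΦ.mfderiv Φ (fun _ => (0 : ℝ)) contMDiffAt_const (m := ∞) (by simp))
    contMDiffAt_const hΦ0_smooth
  have hcast (b y : TotalSpace F A) (hby : b = y) (v : EA) :
      (⟨b, v⟩ : TangentBundle IA (TotalSpace F A)) = ⟨y, v⟩ := by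
    rw [hby]
  exact h.congr_of_eventuallyEq
    (.of_forall fun b => hcast b (Φ b 0) (hΦ0 b).symm (lineVelocity IA b (w b)))

theorem contMDiffAt_gammaField [FiniteDimensional ℝ F] [IsManifold IB ∞ M]
    [IsManifold IA ∞ (TotalSpace F A)] [ContMDiffVectorBundle ∞ F E IB]
    [SmoothAffineBundle F E A IB IA] {f : TotalSpace F A → ℝ} {h : DualSpace F E → ℝ}
    {a : TotalSpace F A} (hf : ContMDiffAt IA 𝓘(ℝ, ℝ) ∞ f a)
    (hh : ContMDiffAt (IB.prod 𝓘(ℝ, F →L[ℝ] ℝ)) 𝓘(ℝ, ℝ) ∞ h (fibreDeriv f a)) :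
    ContMDiffAt IA IA.tangent ∞
      (fun b => (⟨b, gammaField IB IA f h b⟩ : TangentBundle IA (TotalSpace F A))) a := by
  simpa only [gammaField, vertLift_apply] using
    contMDiffAt_lineVelocity IB (contMDiffAt_gammaMap hf hh)

variable (IB IA) in
/-- The vertical lift at `a`, as a linear map with values in `T_a A`. -/
def vertLiftTangent [ContMDiffVectorBundle ∞ F E IB] [SmoothAffineBundle F E A IB IA]
    (a : TotalSpace F A) : E a.1 →ₗ[ℝ] TangentSpace IA a :=
  (verticalSpace IB IA a).subtype ∘ₗ (vertLift IB IA a).toLinearMap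

section VertLiftTangent

variable [ContMDiffVectorBundle ∞ F E IB] [SmoothAffineBundle F E A IB IA]

theorem vertLiftTangent_apply (a : TotalSpace F A) (e : E a.1) :
    vertLiftTangent IB IA a e = lineVelocity IA a e :=
  vertLift_apply IB IA a e

theorem ker_vertLiftTangent (a : TotalSpace F A) :
    LinearMap.ker (vertLiftTangent (E := E) IB IA a) = ⊥ :=
  LinearMap.ker_eq_bot.2 (Subtype.val_injective.comp (vertLift IB IA a).injective)

theorem range_vertLiftTangent (a : TotalSpace F A) :
    LinearMap.range (vertLiftTangent (E := E) IB IA a) = verticalSpace IB IA a := by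
  rw [vertLiftTangent, LinearMap.range_comp, LinearEquiv.range, Submodule.map_top,
    Submodule.range_subtype]

theorem kerHessianOp_eq_map_ker_fibreHessian (f : TotalSpace F A → ℝ) (a : TotalSpace F A) :
    kerHessianOp (E := E) IB IA f a =
      (LinearMap.ker (fibreHessian (E := E) f a).toLinearMap).map (vertLiftTangent IB IA a) := by
  have hker : LinearMap.ker (hessianOp (E := E) IB IA f a) =
      (LinearMap.ker (fibreHessian (E := E) f a).toLinearMap).map
        (vertLift IB IA a).toLinearMap := by
    ext w
    obtain ⟨e, rfl⟩ := (vertLift (E := E) IB IA a).surjective w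
    rw [Submodule.map_equiv_eq_comap_symm, Submodule.mem_comap, LinearMap.mem_ker,
      LinearMap.mem_ker]
    refine ⟨fun h => ContinuousLinearMap.ext fun e' => ?_, fun h => LinearMap.ext fun w => ?_⟩
    · simpa [hessianOp_apply] using LinearMap.congr_fun h (vertLift IB IA a e')
    · exact DFunLike.congr_fun h ((vertLift IB IA a).symm w)
  rw [kerHessianOp, hker, vertLiftTangent, Submodule.map_comp]

end VertLiftTangent

variable (IB) in
/-- The vertical lift `vl_p` of the dual bundle `E^*`, with values in `T_p E^*`. -/
abbrev dualVertLift [ContMDiffVectorBundle ∞ F E IB] [IsManifold IB ∞ M] (p : DualSpace F E) :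
    (E p.1 →L[ℝ] ℝ) →ₗ[ℝ] TangentSpace (IB.prod 𝓘(ℝ, F →L[ℝ] ℝ)) p :=
  vertLiftTangent (E := fun x => E x →L[ℝ] Trivial M ℝ x) IB (IB.prod 𝓘(ℝ, F →L[ℝ] ℝ)) p

variable [IsManifold IB ∞ M] [ContMDiffVectorBundle ∞ F E IB]

theorem dualVertLift_apply (p : DualSpace F E) (α : E p.1 →L[ℝ] ℝ) :
    dualVertLift IB p α = lineVelocity (E := fun x => E x →L[ℝ] Trivial M ℝ x)
      (IB.prod 𝓘(ℝ, F →L[ℝ] ℝ)) p α :=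
  vertLiftTangent_apply p α

omit [TopologicalSpace (TotalSpace F A)] in
theorem mvfderiv_dualVertLift_eq_apply_gammaMap [FiniteDimensional ℝ F]
    (f : TotalSpace F A → ℝ) {h : DualSpace F E → ℝ} {a : TotalSpace F A}
    (hh : MDifferentiableAt (IB.prod 𝓘(ℝ, F →L[ℝ] ℝ)) 𝓘(ℝ, ℝ) h (fibreDeriv f a))
    (α : E a.1 →L[ℝ] ℝ) :
    mvfderiv (IB.prod 𝓘(ℝ, F →L[ℝ] ℝ)) h (fibreDeriv f a)
      (dualVertLift IB (fibreDeriv (E := E) f a) α) = α (gammaMap f h a) := by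
  rw [apply_gammaMap]
  exact (congrArg _ (dualVertLift_apply (fibreDeriv (E := E) f a) α)).trans
    (mvfderiv_lineVelocity IB (E := fun x => E x →L[ℝ] Trivial M ℝ x) hh α)

variable [SmoothAffineBundle F E A IB IA] {f : TotalSpace F A → ℝ} {a : TotalSpace F A}

theorem mfderiv_fibreDeriv_vertLiftTangent (hf : ContMDiffAt IA 𝓘(ℝ, ℝ) ∞ f a) (e : E a.1) :
    mfderiv IA (IB.prod 𝓘(ℝ, F →L[ℝ] ℝ)) (fibreDeriv (E := E) f) a (vertLiftTangent IB IA a e) =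
      dualVertLift IB (fibreDeriv (E := E) f a) (fibreHessian f a e) := by
  rw [vertLiftTangent_apply]
  refine Eq.trans ?_ (dualVertLift_apply (fibreDeriv (E := E) f a) (fibreHessian f a e)).symm
  exact mfderiv_lineVelocity IB (F' := F →L[ℝ] ℝ) (E' := fun x => E x →L[ℝ] Trivial M ℝ x)
    (A' := fun x => E x →L[ℝ] Trivial M ℝ x) (IA' := IB.prod 𝓘(ℝ, F →L[ℝ] ℝ))
    (Φ := fun x p => (fibreDeriv (E := E) f ⟨x, p⟩).2) (contMDiffAt_fibreDeriv hf) e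

theorem mfderiv_proj_mfderiv_fibreDeriv (hf : ContMDiffAt IA 𝓘(ℝ, ℝ) ∞ f a)
    (v : TangentSpace IA a) :
    mfderiv (IB.prod 𝓘(ℝ, F →L[ℝ] ℝ)) IB (π (F →L[ℝ] ℝ) fun x => E x →L[ℝ] Trivial M ℝ x)
        (fibreDeriv (E := E) f a)
        (mfderiv IA (IB.prod 𝓘(ℝ, F →L[ℝ] ℝ)) (fibreDeriv (E := E) f) a v) =
      mfderiv IA IB (π F A) a v :=
  (mfderiv_comp_apply a ((contMDiff_proj (n := ∞) _).mdifferentiableAt (by simp))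
    ((contMDiffAt_fibreDeriv (E := E) (IB := IB) hf).mdifferentiableAt (by simp)) v).symm

theorem mfderiv_fibreDeriv_eq_dualVertLift_iff (hf : ContMDiffAt IA 𝓘(ℝ, ℝ) ∞ f a)
    {v : TangentSpace IA a} {β : E a.1 →L[ℝ] ℝ} :
    mfderiv IA (IB.prod 𝓘(ℝ, F →L[ℝ] ℝ)) (fibreDeriv (E := E) f) a v =
        dualVertLift IB (fibreDeriv (E := E) f a) β ↔
      ∃ e : E a.1, fibreHessian f a e = β ∧ vertLiftTangent IB IA a e = v := by
  constructor
  · intro hv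
    have hvert : v ∈ verticalSpace IB IA a := by
      refine (mfderiv_proj_mfderiv_fibreDeriv (E := E) (IB := IB) hf v).symm.trans ?_
      rw [hv]
      exact (range_vertLiftTangent (IB := IB) (E := fun x => E x →L[ℝ] Trivial M ℝ x)
        (fibreDeriv (E := E) f a)).le ⟨β, rfl⟩
    rw [← range_vertLiftTangent (E := E)] at hvert
    obtain ⟨e, rfl⟩ := hvert
    refine ⟨e, LinearMap.ker_eq_bot.1 (ker_vertLiftTangent (IB := IB)
      (IA := IB.prod 𝓘(ℝ, F →L[ℝ] ℝ)) (E := fun x => E x →L[ℝ] Trivial M ℝ x)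
      (fibreDeriv (E := E) f a)) ?_, rfl⟩
    exact (mfderiv_fibreDeriv_vertLiftTangent hf e).symm.trans hv
  · rintro ⟨e, rfl, rfl⟩
    exact mfderiv_fibreDeriv_vertLiftTangent hf e

theorem kerTangentFibreDeriv_eq_map_ker_fibreHessian (hf : ContMDiffAt IA 𝓘(ℝ, ℝ) ∞ f a) :
    kerTangentFibreDeriv (E := E) IB IA f a =
      (LinearMap.ker (fibreHessian (E := E) f a).toLinearMap).map (vertLiftTangent IB IA a) := by
  ext v
  refine Iff.trans ?_ (mfderiv_fibreDeriv_eq_dualVertLift_iff hf (β := 0))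
  exact Eq.congr_right (map_zero (dualVertLift IB (fibreDeriv (E := E) f a))).symm

end TangentFibreDeriv

theorem ker_eq_span_range_of_range_eq {𝕜 V ι : Type*} [Field 𝕜] [AddCommGroup V] [Module 𝕜 V]
    {D : V →ₗ[𝕜] Module.Dual 𝕜 V} (hsymm : ∀ v w, D v w = D w v) {γ : ι → V}
    (hrange : ∀ α, α ∈ LinearMap.range D ↔ ∀ i, α (γ i) = 0) :
    LinearMap.ker D = Submodule.span 𝕜 (Set.range γ) := by
  have hflip : D.flip = D := LinearMap.ext₂ fun v w => hsymm w v
  have hannihilator :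
      LinearMap.range D = (Submodule.span 𝕜 (Set.range γ)).dualAnnihilator := by
    ext α
    rw [hrange, Submodule.mem_dualAnnihilator]
    refine ⟨fun h v hv => ?_, fun h i => h _ (Submodule.subset_span ⟨i, rfl⟩)⟩
    exact (Submodule.span_le (p := LinearMap.ker α)).2 (Set.range_subset_iff.2 h) hv
  rw [← Subspace.dualAnnihilator_dualCoannihilator_eq (W := Submodule.span 𝕜 (Set.range γ)),
    ← hannihilator, LinearMap.dualCoannihilator_range_eq_ker_flip, hflip]

/-! ### Immersions and submersions in charts -/

section SliceMap

open Manifold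

variable {𝕜 EX HX X EY HY Y : Type*} [NontriviallyNormedField 𝕜]
  [NormedAddCommGroup EX] [NormedSpace 𝕜 EX] [TopologicalSpace HX]
  {I : ModelWithCorners 𝕜 EX HX} [TopologicalSpace X] [ChartedSpace HX X]
  [NormedAddCommGroup EY] [NormedSpace 𝕜 EY] [TopologicalSpace HY]
  {J : ModelWithCorners 𝕜 EY HY} [TopologicalSpace Y] [ChartedSpace HY Y] {n : ℕ∞ω}

theorem isLocalDiffeomorphAt_extend [J.Boundaryless] {e : OpenPartialHomeomorph Y HY}
    (he : e ∈ IsManifold.maximalAtlas J n Y) {y : Y} (hy : y ∈ e.source) :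
    IsLocalDiffeomorphAt J 𝓘(𝕜, EY) n (e.extend J) y := by
  let Φ : PartialDiffeomorph J 𝓘(𝕜, EY) Y EY n :=
    { toPartialEquiv := e.extend J
      open_source := e.isOpen_extend_source
      open_target := e.isOpen_extend_target
      contMDiffOn_toFun := by simpa only [e.extend_source] using e.contMDiffOn_extend he
      contMDiffOn_invFun := by rw [e.extend_target']; exact contMDiffOn_extend_symm he }
  exact ⟨Φ, (e.extend_source (I := J)).symm ▸ hy, Set.eqOn_refl _ _⟩

theorem bijective_mfderiv_extend [J.Boundaryless] {e : OpenPartialHomeomorph Y HY}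
    (he : e ∈ IsManifold.maximalAtlas J n Y) (hn : n ≠ 0) {y : Y} (hy : y ∈ e.source) :
    Function.Bijective (mfderiv J 𝓘(𝕜, EY) (e.extend J) y) :=
  ((isLocalDiffeomorphAt_extend he hy).mfderivToContinuousLinearEquiv hn).bijective

theorem extend_codChart_apply_of_isSubmersionAt {g : X → Y} {x : X} (hg : IsSubmersionAt I J n g x)
    {x' : X} (hx' : x' ∈ hg.domChart.source) :
    hg.codChart.extend J (g x') = (hg.equiv (hg.domChart.extend I x')).1 := by
  have hx'_extend : x' ∈ (hg.domChart.extend I).source := by rwa [hg.domChart.extend_source]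
  have h := hg.writtenInCharts ((hg.domChart.extend I).map_source hx'_extend)
  simp only [Function.comp_apply] at h
  rwa [(hg.domChart.extend I).left_inv hx'_extend] at h

theorem surjective_mfderiv_of_isSubmersionAt [I.Boundaryless] [J.Boundaryless] {g : X → Y} {x : X}
    (hg : IsSubmersionAt I J n g x) (hn : n ≠ 0) : Function.Surjective (mfderiv I J g x) := by
  have hdom := hg.domChart.contMDiffAt_extend hg.domChart_mem_maximalAtlas hg.mem_domChart_source
  have hcod := hg.codChart.contMDiffAt_extend hg.codChart_mem_maximalAtlas hg.mem_codChart_source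
  have hderiv (v : TangentSpace I x) :
      mfderiv J 𝓘(𝕜, EY) (hg.codChart.extend J) (g x) (mfderiv I J g x v) =
        (hg.equiv (mfderiv I 𝓘(𝕜, EX) (hg.domChart.extend I) x v)).1 := by
    let fstEquiv : EX →L[𝕜] EY := (ContinuousLinearMap.fst 𝕜 EY hg.complement).comp
      (hg.equiv : EX →L[𝕜] EY × hg.complement)
    have hread : hg.codChart.extend J ∘ g =ᶠ[𝓝 x] fstEquiv ∘ hg.domChart.extend I := by
      filter_upwards [hg.domChart.open_source.mem_nhds hg.mem_domChart_source] with x' hx'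
      exact extend_codChart_apply_of_isSubmersionAt hg hx'
    have hcomp := (hcod.mdifferentiableAt hn).hasMFDerivAt.comp x
      (hg.contMDiffAt.mdifferentiableAt hn).hasMFDerivAt
    have hcomp' := fstEquiv.hasMFDerivAt.comp x (hdom.mdifferentiableAt hn).hasMFDerivAt
    exact DFunLike.congr_fun (hasMFDerivAt_unique hcomp (hcomp'.congr_of_eventuallyEq hread)) v
  intro w
  obtain ⟨v, hv⟩ := (bijective_mfderiv_extend hg.domChart_mem_maximalAtlas hn
    hg.mem_domChart_source).surjective
      (hg.equiv.symm (mfderiv J 𝓘(𝕜, EY) (hg.codChart.extend J) (g x) w, 0))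
  refine ⟨v, (bijective_mfderiv_extend hg.codChart_mem_maximalAtlas hn
    hg.mem_codChart_source).injective ?_⟩
  rw [hderiv, hv, ContinuousLinearEquiv.apply_symm_apply]

/-- The slice map of an immersion `g` at `x`: in the charts where `g` is the inclusion
`u ↦ (u, 0)`, it is the projection `(u, c) ↦ c`. Its zeros are, locally, the points of the
image of `g`. -/
def sliceMap {g : X → Y} {x : X} (hg : IsImmersionAt I J n g x) (y : Y) : hg.complement :=
  (hg.equiv.symm (hg.codChart.extend J y)).2

variable {g : X → Y} {x : X} (hg : IsImmersionAt I J n g x)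

theorem extend_codChart_apply_of_isImmersionAt {x' : X} (hx' : x' ∈ hg.domChart.source) :
    hg.codChart.extend J (g x') = hg.equiv (hg.domChart.extend I x', 0) := by
  have hx'_extend : x' ∈ (hg.domChart.extend I).source := by rwa [hg.domChart.extend_source]
  have h := hg.writtenInCharts ((hg.domChart.extend I).map_source hx'_extend)
  simp only [Function.comp_apply] at h
  rwa [(hg.domChart.extend I).left_inv hx'_extend] at h

theorem sliceMap_apply_eq_zero {x' : X} (hx' : x' ∈ hg.domChart.source) :
    sliceMap hg (g x') = 0 := by
  rw [sliceMap, extend_codChart_apply_of_isImmersionAt hg hx',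
    ContinuousLinearEquiv.symm_apply_apply]

theorem contMDiffOn_sliceMap :
    ContMDiffOn J 𝓘(𝕜, hg.complement) n (sliceMap hg) hg.codChart.source :=
  ((ContinuousLinearMap.snd 𝕜 EX hg.complement).comp
    (hg.equiv.symm : EY →L[𝕜] EX × hg.complement)).contMDiff.comp_contMDiffOn
      (hg.codChart.contMDiffOn_extend hg.codChart_mem_maximalAtlas)

theorem mfderiv_sliceMap_apply (hn : n ≠ 0) {y : Y} (hy : y ∈ hg.codChart.source)
    (w : TangentSpace J y) :
    mfderiv J 𝓘(𝕜, hg.complement) (sliceMap hg) y w =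
      (hg.equiv.symm (mfderiv J 𝓘(𝕜, EY) (hg.codChart.extend J) y w)).2 := by
  have hcod := hg.codChart.contMDiffAt_extend hg.codChart_mem_maximalAtlas hy
  have hcomp := ((ContinuousLinearMap.snd 𝕜 EX hg.complement).comp
    (hg.equiv.symm : EY →L[𝕜] EX × hg.complement)).hasMFDerivAt.comp y
      (hcod.mdifferentiableAt hn).hasMFDerivAt
  exact DFunLike.congr_fun hcomp.mfderiv w

theorem surjective_mfderiv_sliceMap [J.Boundaryless] (hn : n ≠ 0) {y : Y}
    (hy : y ∈ hg.codChart.source) :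
    Function.Surjective (mfderiv J 𝓘(𝕜, hg.complement) (sliceMap hg) y) := by
  intro c
  obtain ⟨w, hw⟩ := (bijective_mfderiv_extend hg.codChart_mem_maximalAtlas hn hy).surjective
    (hg.equiv (0, c))
  exact ⟨w, by rw [mfderiv_sliceMap_apply hg hn hy, hw, ContinuousLinearEquiv.symm_apply_apply]⟩

theorem mem_range_mfderiv_of_mfderiv_sliceMap_eq_zero [I.Boundaryless] [J.Boundaryless]
    (hn : n ≠ 0) {w : TangentSpace J (g x)}
    (hw : mfderiv J 𝓘(𝕜, hg.complement) (sliceMap hg) (g x) w = 0) :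
    w ∈ Set.range (mfderiv I J g x) := by
  have hdom := hg.domChart.contMDiffAt_extend hg.domChart_mem_maximalAtlas hg.mem_domChart_source
  have hcod := hg.codChart.contMDiffAt_extend hg.codChart_mem_maximalAtlas hg.mem_codChart_source
  have hderiv (v : TangentSpace I x) :
      mfderiv J 𝓘(𝕜, EY) (hg.codChart.extend J) (g x) (mfderiv I J g x v) =
        hg.equiv (mfderiv I 𝓘(𝕜, EX) (hg.domChart.extend I) x v, 0) := by
    let equivInl : EX →L[𝕜] EY :=
      (hg.equiv : EX × hg.complement →L[𝕜] EY).comp (ContinuousLinearMap.inl 𝕜 EX hg.complement)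
    have hread : hg.codChart.extend J ∘ g =ᶠ[𝓝 x] equivInl ∘ hg.domChart.extend I := by
      filter_upwards [hg.domChart.open_source.mem_nhds hg.mem_domChart_source] with x' hx'
      exact extend_codChart_apply_of_isImmersionAt hg hx'
    have hcomp := (hcod.mdifferentiableAt hn).hasMFDerivAt.comp x
      (hg.contMDiffAt.mdifferentiableAt hn).hasMFDerivAt
    have hcomp' := equivInl.hasMFDerivAt.comp x (hdom.mdifferentiableAt hn).hasMFDerivAt
    exact DFunLike.congr_fun (hasMFDerivAt_unique hcomp (hcomp'.congr_of_eventuallyEq hread)) v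
  let u := (hg.equiv.symm (mfderiv J 𝓘(𝕜, EY) (hg.codChart.extend J) (g x) w)).1
  obtain ⟨v, hv⟩ := (bijective_mfderiv_extend hg.domChart_mem_maximalAtlas hn
    hg.mem_domChart_source).surjective u
  refine ⟨v, (bijective_mfderiv_extend hg.codChart_mem_maximalAtlas hn
    hg.mem_codChart_source).injective ?_⟩
  rw [mfderiv_sliceMap_apply hg hn hg.mem_codChart_source] at hw
  rw [hderiv, hv]
  exact (congrArg (fun c => hg.equiv (u, c)) hw.symm).trans (hg.equiv.apply_symm_apply _)

theorem mem_range_of_sliceMap_eq_zero {y : Y} (hy : y ∈ hg.codChart.source)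
    (htarget : (hg.equiv.symm (hg.codChart.extend J y)).1 ∈ (hg.domChart.extend I).target)
    (hy0 : sliceMap hg y = 0) : y ∈ Set.range g := by
  set u := (hg.equiv.symm (hg.codChart.extend J y)).1 with hu
  let x' := (hg.domChart.extend I).symm u
  have hx' : x' ∈ hg.domChart.source :=
    hg.domChart.extend_source (I := I) ▸ (hg.domChart.extend I).map_target htarget
  have hcod : hg.codChart.extend J (g x') = hg.codChart.extend J y := by
    rw [extend_codChart_apply_of_isImmersionAt hg hx', (hg.domChart.extend I).right_inv htarget,
      ← hy0, hu, sliceMap, Prod.mk.eta, ContinuousLinearEquiv.apply_symm_apply]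
  refine ⟨x', (hg.codChart.extend J).injOn ?_ ?_ hcod⟩
  · exact (hg.codChart.extend_source (I := J)).symm ▸ hg.source_subset_preimage_source hx'
  · exact (hg.codChart.extend_source (I := J)).symm ▸ hy

theorem exists_isOpen_inter_range_eq_sliceMap_eq_zero [I.Boundaryless]
    (hemb : Topology.IsInducing g) :
    ∃ W : Set Y, IsOpen W ∧ g x ∈ W ∧ W ⊆ hg.codChart.source ∧
      Set.range g ∩ W = {y ∈ W | sliceMap hg y = 0} := by
  obtain ⟨O, hO, hgO⟩ := hemb.isOpen_iff.1 hg.domChart.open_source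
  let u (y : Y) : EX := (hg.equiv.symm (hg.codChart.extend J y)).1
  have hu : ContinuousOn u hg.codChart.source :=
    (continuous_fst.comp hg.equiv.symm.continuous).comp_continuousOn
      (hg.codChart.contMDiffOn_extend hg.codChart_mem_maximalAtlas).continuousOn
  have hu_x : u (g x) ∈ (hg.domChart.extend I).target := by
    simp only [u]
    rw [extend_codChart_apply_of_isImmersionAt hg hg.mem_domChart_source,
      ContinuousLinearEquiv.symm_apply_apply]
    exact (hg.domChart.extend I).map_source
      ((hg.domChart.extend_source (I := I)).symm ▸ hg.mem_domChart_source)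
  refine ⟨hg.codChart.source ∩ u ⁻¹' (hg.domChart.extend I).target ∩ O,
    (hu.isOpen_inter_preimage hg.codChart.open_source hg.domChart.isOpen_extend_target).inter hO,
    ⟨⟨hg.mem_codChart_source, hu_x⟩, hgO.symm.le hg.mem_domChart_source⟩,
    fun y hy => hy.1.1, Set.ext fun y => ⟨?_, ?_⟩⟩
  · rintro ⟨⟨x', rfl⟩, hx'⟩
    exact ⟨hx', sliceMap_apply_eq_zero hg (hgO.le hx'.2)⟩
  · rintro ⟨hy, hy0⟩
    exact ⟨mem_range_of_sliceMap_eq_zero hg hy.1.1 hy.1.2 hy0, hy⟩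

end SliceMap

section DefiningFunctions

open Manifold

variable {EX HX X EY HY Y : Type*}
  [NormedAddCommGroup EX] [NormedSpace ℝ EX] [TopologicalSpace HX]
  {I : ModelWithCorners ℝ EX HX} [TopologicalSpace X] [ChartedSpace HX X]
  [NormedAddCommGroup EY] [NormedSpace ℝ EY] [TopologicalSpace HY]
  {J : ModelWithCorners ℝ EY HY} [TopologicalSpace Y] [ChartedSpace HY Y]

theorem hasStrictFDerivAt_comp_extChartAt_symm [J.Boundaryless] {W : Type*}
    [NormedAddCommGroup W] [NormedSpace ℝ W] {n : ℕ∞ω} (hn : n ≠ 0) {ψ : Y → W} {p : Y}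
    (hψ : ContMDiffAt J 𝓘(ℝ, W) n ψ p) :
    HasStrictFDerivAt (ψ ∘ (extChartAt J p).symm) (mvfderiv J ψ p) (extChartAt J p p) := by
  have hread : ContDiffAt ℝ n (ψ ∘ (extChartAt J p).symm) (extChartAt J p p) := by
    have h := (contMDiffAt_iff.1 hψ).2
    rwa [J.range_eq_univ, contDiffWithinAt_univ] at h
  have hderiv : mvfderiv J ψ p = fderiv ℝ (ψ ∘ (extChartAt J p).symm) (extChartAt J p p) := by
    have h := (hψ.mdifferentiableAt hn).mfderiv
    rw [J.range_eq_univ, fderivWithin_univ] at h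
    exact h
  exact hderiv ▸ hread.hasStrictFDerivAt hn

theorem DefinesOn.contMDiffAt {k : ℕ} {φ : Fin k → Y → ℝ} {S U : Set Y}
    (hφ : DefinesOn J φ S U) {p : Y} (hp : p ∈ U) (μ : Fin k) :
    ContMDiffAt J 𝓘(ℝ, ℝ) ∞ (φ μ) p :=
  (hφ.contMDiffOn μ).contMDiffAt (hφ.isOpen.mem_nhds hp)

/- The Lagrange multiplier theorem in a chart: `ψ` has a constrained extremum at `p` because it is
constant on the constraint set. -/
theorem mvfderiv_mem_span_of_eventually_eq_zero [CompleteSpace EY] [J.Boundaryless] {k : ℕ}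
    {φ : Fin k → Y → ℝ} {S U : Set Y} (hφ : DefinesOn J φ S U) {p : Y} (hp : p ∈ S ∩ U)
    {ψ : Y → ℝ} (hψ : ContMDiffAt J 𝓘(ℝ, ℝ) ∞ ψ p) (hψ0 : ∀ᶠ q in 𝓝[S] p, ψ q = 0) :
    mvfderiv J ψ p ∈ Submodule.span ℝ (Set.range fun μ => mvfderiv J (φ μ) p) := by
  have hsymm : Filter.Tendsto (extChartAt J p).symm (𝓝 (extChartAt J p p)) (𝓝 p) := by
    simpa only [ContinuousAt, extChartAt_to_inv] using continuousAt_extChartAt_symm (I := J) p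
  have hψp : ψ p = 0 := hψ0.self_of_nhdsWithin hp.1
  have hφp (μ : Fin k) : φ μ p = 0 := (hφ.inter_eq.le hp).2 μ
  have hextr : IsLocalExtrOn (ψ ∘ (extChartAt J p).symm)
      {z | ∀ μ, (φ μ ∘ (extChartAt J p).symm) z =
        (φ μ ∘ (extChartAt J p).symm) (extChartAt J p p)} (extChartAt J p p) := by
    refine Or.inl (eventually_nhdsWithin_iff.2 ?_)
    filter_upwards [hsymm.eventually (hφ.isOpen.mem_nhds hp.2),
      hsymm.eventually (eventually_nhdsWithin_iff.1 hψ0)] with z hzU hz hzφ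
    simp only [Function.comp_apply, extChartAt_to_inv, hφp] at hzφ
    simp only [Function.comp_apply, extChartAt_to_inv, hψp]
    exact (hz (hφ.inter_eq.ge ⟨hzU, hzφ⟩).1).ge
  have hdependent := hextr.linear_dependent_of_hasStrictFDerivAt
    (fun μ => hasStrictFDerivAt_comp_extChartAt_symm (by simp) (hφ.contMDiffAt hp.2 μ))
    (hasStrictFDerivAt_comp_extChartAt_symm (by simp) hψ)
  by_contra hnot_mem
  exact hdependent (linearIndependent_option.2 ⟨hφ.linearIndependent p hp, hnot_mem⟩)

theorem mvfderiv_mfderiv_eq_zero_of_definesOn {k : ℕ} {φ : Fin k → Y → ℝ} {g : X → Y}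
    {U : Set Y} (hφ : DefinesOn J φ (Set.range g) U) {x : X} (hx : g x ∈ U)
    (hg : MDifferentiableAt I J g x) (v : TangentSpace I x) (μ : Fin k) :
    mvfderiv J (φ μ) (g x) (mfderiv I J g x v) = 0 := by
  have hzero : φ μ ∘ g =ᶠ[𝓝 x] fun _ => 0 := by
    filter_upwards [hg.continuousAt (hφ.isOpen.mem_nhds hx)] with x' hx'
    exact (hφ.inter_eq.le ⟨⟨x', rfl⟩, hx'⟩).2 μ
  have hφx : MDifferentiableAt J 𝓘(ℝ, ℝ) (φ μ) (g x) :=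
    (hφ.contMDiffAt hx μ).mdifferentiableAt (by simp)
  have hcomp := hφx.hasMFDerivAt.comp x hg.hasMFDerivAt
  exact DFunLike.congr_fun (hasMFDerivAt_unique hcomp
    ((hasMFDerivAt_const (0 : ℝ) x).congr_of_eventuallyEq hzero)) v

theorem mem_range_mfderiv_iff_of_isImmersionAt [CompleteSpace EY] [I.Boundaryless]
    [J.Boundaryless] {k : ℕ} {φ : Fin k → Y → ℝ} {g : X → Y} {U : Set Y}
    (hφ : DefinesOn J φ (Set.range g) U) {x : X} (hx : g x ∈ U) (hg : IsImmersionAt I J ∞ g x)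
    (hemb : Topology.IsInducing g) (w : TangentSpace J (g x)) :
    w ∈ Set.range (mfderiv I J g x) ↔ ∀ μ, mvfderiv J (φ μ) (g x) w = 0 := by
  refine ⟨?_, fun hw => ?_⟩
  · have hgx : MDifferentiableAt I J g x := hg.contMDiffAt.mdifferentiableAt (by simp)
    rintro ⟨v, rfl⟩ μ
    exact mvfderiv_mfderiv_eq_zero_of_definesOn hφ hx hgx v μ
  obtain ⟨W, hW, hxW, -, hWrange⟩ := exists_isOpen_inter_range_eq_sliceMap_eq_zero hg hemb
  have hslice : ContMDiffAt J 𝓘(ℝ, hg.complement) ∞ (sliceMap hg) (g x) :=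
    (contMDiffOn_sliceMap hg).contMDiffAt (hg.codChart.open_source.mem_nhds hg.mem_codChart_source)
  refine mem_range_mfderiv_of_mfderiv_sliceMap_eq_zero hg (by simp)
    ((SeparatingDual.eq_zero_iff_forall_dual_eq_zero (R := ℝ) (V := hg.complement) _).2
      fun ℓ => ?_)
  have hℓ : mvfderiv J (ℓ ∘ sliceMap hg) (g x) w =
      ℓ (mfderiv J 𝓘(ℝ, hg.complement) (sliceMap hg) (g x) w) :=
    DFunLike.congr_fun
      (ℓ.hasMFDerivAt.comp (g x) (hslice.mdifferentiableAt (by simp)).hasMFDerivAt).mfderiv w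
  have hzero : ∀ᶠ q in 𝓝[Set.range g] g x, (ℓ ∘ sliceMap hg) q = 0 := by
    filter_upwards [self_mem_nhdsWithin, mem_nhdsWithin_of_mem_nhds (hW.mem_nhds hxW)]
      with q hq hqW
    rw [Function.comp_apply, (hWrange.le ⟨hq, hqW⟩).2, map_zero]
  have hspan := mvfderiv_mem_span_of_eventually_eq_zero hφ ⟨⟨x, rfl⟩, hx⟩
    (ℓ.contMDiff.contMDiffAt.comp (g x) hslice) hzero
  rw [← hℓ]
  exact (Submodule.span_le
    (p := LinearMap.ker (ContinuousLinearMap.apply ℝ ℝ (E := EY) w).toLinearMap)).2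
      (Set.range_subset_iff.2 hw) hspan

theorem linearIndependent_mvfderiv_coord {W : Type*} [NormedAddCommGroup W] [NormedSpace ℝ W]
    {ι : Type*} [Finite ι] (b : Module.Basis ι ℝ W) {ψ : Y → W} {q : Y}
    (hψ : MDifferentiableAt J 𝓘(ℝ, W) ψ q)
    (hsurj : Function.Surjective (mfderiv J 𝓘(ℝ, W) ψ q)) :
    LinearIndependent ℝ fun i => mvfderiv J (fun y => b.coord i (ψ y)) q := by
  have : FiniteDimensional ℝ W := b.finiteDimensional_of_finite
  have hcoord (i : ι) (v : TangentSpace J q) :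
      mvfderiv J (fun y => b.coord i (ψ y)) q v = b.coord i (mfderiv J 𝓘(ℝ, W) ψ q v) :=
    DFunLike.congr_fun
      ((b.coord i).toContinuousLinearMap.hasMFDerivAt.comp q hψ.hasMFDerivAt).mfderiv v
  choose v hv using fun i => hsurj (b i)
  refine LinearIndependent.of_pairwise_dual_eq_zero_one _
    (fun i => (ContinuousLinearMap.apply ℝ ℝ (E := EY) (v i)).toLinearMap) ?_ ?_
  · intro i j hij
    exact (hcoord j (v i)).trans
      (by rw [hv, b.coord_apply, b.repr_self, Finsupp.single_eq_of_ne hij.symm])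
  · intro i
    exact (hcoord i (v i)).trans
      (by rw [hv, b.coord_apply, b.repr_self, Finsupp.single_eq_same])

theorem exists_contMDiff_eventuallyEq [FiniteDimensional ℝ EY] [T2Space Y] [IsManifold J ∞ Y]
    {W : Type*} [NormedAddCommGroup W] [NormedSpace ℝ W] {ψ : Y → W} {O : Set Y} (hO : IsOpen O)
    (hψ : ContMDiffOn J 𝓘(ℝ, W) ∞ ψ O) {p : Y} (hp : p ∈ O) :
    ∃ ψ' : Y → W, ContMDiff J 𝓘(ℝ, W) ∞ ψ' ∧ ψ' =ᶠ[𝓝 p] ψ := by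
  obtain ⟨b, -, hb⟩ := (SmoothBumpFunction.nhds_basis_tsupport (I := J) p).mem_iff.1
    (hO.mem_nhds hp)
  refine ⟨fun q => b q • ψ q, contMDiff_of_tsupport fun q hq => ?_, ?_⟩
  · have hqO : q ∈ O := hb (tsupport_smul_subset_left _ _ hq)
    exact b.contMDiffAt.smul (hψ.contMDiffAt (hO.mem_nhds hqO))
  · filter_upwards [b.eventuallyEq_one] with q hq
    rw [hq, Pi.one_apply, one_smul]

theorem exists_definesOn_of_isImmersionAt [FiniteDimensional ℝ EY] [T2Space Y]
    [IsManifold J ∞ Y] [I.Boundaryless] [J.Boundaryless] {g : X → Y} {x : X}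
    (hg : IsImmersionAt I J ∞ g x) (hemb : Topology.IsInducing g) :
    ∃ (U : Set Y) (k : ℕ) (φ : Fin k → Y → ℝ), g x ∈ U ∧
      (∀ μ, ContMDiff J 𝓘(ℝ, ℝ) ∞ (φ μ)) ∧
      (∀ q ∈ U, LinearIndependent ℝ fun μ => mvfderiv J (φ μ) q) ∧
      DefinesOn J φ (Set.range g) U := by
  obtain ⟨W, hW, hxW, hWsource, hWrange⟩ := exists_isOpen_inter_range_eq_sliceMap_eq_zero hg hemb
  obtain ⟨ψ, hψ, hψ_eq⟩ :=
    exists_contMDiff_eventuallyEq hg.codChart.open_source (contMDiffOn_sliceMap hg)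
      hg.mem_codChart_source
  obtain ⟨O, hψO, hO, hxO⟩ := eventually_nhds_iff.1 hψ_eq
  have : FiniteDimensional ℝ (EX × hg.complement) :=
    hg.equiv.symm.toLinearEquiv.finiteDimensional
  have : FiniteDimensional ℝ hg.complement :=
    Module.Finite.of_surjective (LinearMap.snd ℝ EX hg.complement) LinearMap.snd_surjective
  let b := Module.finBasis ℝ hg.complement
  have hφ (μ) : ContMDiff J 𝓘(ℝ, ℝ) ∞ fun q => b.coord μ (ψ q) :=
    (b.coord μ).toContinuousLinearMap.contMDiff.comp hψ
  have hindep : ∀ q ∈ W ∩ O,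
      LinearIndependent ℝ fun μ => mvfderiv J (fun q => b.coord μ (ψ q)) q := by
    rintro q ⟨hqW, hqO⟩
    refine linearIndependent_mvfderiv_coord b (hψ.mdifferentiableAt (by simp)) ?_
    rw [(Filter.eventuallyEq_of_mem (hO.mem_nhds hqO) hψO).mfderiv_eq]
    exact surjective_mfderiv_sliceMap hg (by simp) (hWsource hqW)
  refine ⟨W ∩ O, _, fun μ q => b.coord μ (ψ q), ⟨hxW, hxO⟩, hφ, hindep, hW.inter hO,
    fun μ => (hφ μ).contMDiffOn, ?_, fun q hq => hindep q hq.2⟩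
  ext q
  rw [← Set.inter_assoc, hWrange]
  simp only [Module.Basis.forall_coord_eq_zero_iff]
  constructor
  · rintro ⟨⟨hqW, hq0⟩, hqO⟩
    exact ⟨⟨hqW, hqO⟩, (hψO q hqO).trans hq0⟩
  · rintro ⟨⟨hqW, hqO⟩, hq0⟩
    exact ⟨⟨hqW, (hψO q hqO).symm.trans hq0⟩, hqO⟩

variable (I J) in
/-- `g : X → Y` is a submersion onto an embedded submanifold of `Y`, not necessarily closed: with
the topology induced by `Y`, its image carries a manifold structure for which the inclusion in `Y`
is a smooth embedding and `g`, as a map onto its image, is a submersion. -/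
def IsSubmersionOntoSubmanifold (g : X → Y) : Prop :=
  ∃ (d : ℕ) (_ : ChartedSpace (EuclideanSpace ℝ (Fin d)) (Set.range g)),
    IsManifold (𝓡 d) ∞ (Set.range g) ∧
    IsSmoothEmbedding (𝓡 d) J ∞ (Subtype.val : Set.range g → Y) ∧
    IsSubmersion I (𝓡 d) ∞ (Set.rangeFactorization g)

theorem IsSubmersionOntoSubmanifold.mem_range_mfderiv_iff [CompleteSpace EY] [I.Boundaryless]
    [J.Boundaryless] {g : X → Y} (hg : IsSubmersionOntoSubmanifold I J g) {k : ℕ}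
    {φ : Fin k → Y → ℝ} {U : Set Y} (hφ : DefinesOn J φ (Set.range g) U) {x : X} (hx : g x ∈ U)
    (w : TangentSpace J (g x)) :
    w ∈ Set.range (mfderiv I J g x) ↔ ∀ μ, mvfderiv J (φ μ) (g x) w = 0 := by
  obtain ⟨d, _, -, hemb, hsub⟩ := hg
  have himm := hemb.isImmersion.isImmersionAt (Set.rangeFactorization g x)
  have hsubx := hsub.isSubmersionAt x
  have hrange : Set.range (mfderiv I J g x) =
      Set.range (mfderiv (𝓡 d) J Subtype.val (Set.rangeFactorization g x)) :=
    (congrArg (fun T : EX →L[ℝ] EY => Set.range T)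
      (mfderiv_comp x (himm.contMDiffAt.mdifferentiableAt (by simp))
        (hsubx.contMDiffAt.mdifferentiableAt (by simp)))).trans
      ((surjective_mfderiv_of_isSubmersionAt hsubx (by simp)).range_comp _)
  have hφ_val : DefinesOn J φ (Set.range (Subtype.val : Set.range g → Y)) U := by
    rwa [Subtype.range_val]
  rw [hrange]
  exact mem_range_mfderiv_iff_of_isImmersionAt hφ_val (x := Set.rangeFactorization g x) hx himm
    hemb.isEmbedding.isInducing w

theorem IsSubmersionOntoSubmanifold.exists_definesOn [FiniteDimensional ℝ EY] [T2Space Y]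
    [IsManifold J ∞ Y] [J.Boundaryless] {g : X → Y} (hg : IsSubmersionOntoSubmanifold I J g)
    {p : Y} (hp : p ∈ Set.range g) :
    ∃ (U : Set Y) (k : ℕ) (φ : Fin k → Y → ℝ), p ∈ U ∧
      (∀ μ, ContMDiff J 𝓘(ℝ, ℝ) ∞ (φ μ)) ∧
      (∀ q ∈ U, LinearIndependent ℝ fun μ => mvfderiv J (φ μ) q) ∧
      DefinesOn J φ (Set.range g) U := by
  obtain ⟨d, _, -, hemb, -⟩ := hg
  have h := exists_definesOn_of_isImmersionAt (hemb.isImmersion.isImmersionAt ⟨p, hp⟩)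
    hemb.isEmbedding.isInducing
  rwa [Subtype.range_val] at h

end DefiningFunctions

theorem t2Space_totalSpace {B : Type*} (F : Type*) (E : B → Type*) [TopologicalSpace B]
    [T2Space B] [TopologicalSpace F] [T2Space F] [∀ x, TopologicalSpace (E x)]
    [TopologicalSpace (TotalSpace F E)] [FiberBundle F E] : T2Space (TotalSpace F E) := by
  refine ⟨fun p q hpq => ?_⟩
  by_cases hproj : p.proj = q.proj
  · let e := trivializationAt F E p.proj
    have : T2Space e.source := e.toHomeomorphSourceTarget.symm.t2Space
    have hp : p ∈ e.source := FiberBundle.mem_trivializationAt_proj_source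
    have hq : q ∈ e.source := e.mem_source.2 (hproj ▸ e.mem_source.1 hp)
    exact separated_by_isOpenEmbedding e.open_source.isOpenEmbedding_subtypeVal
      (x := ⟨p, hp⟩) (y := ⟨q, hq⟩) (Subtype.coe_ne_coe.1 hpq)
  · exact separated_by_continuous (FiberBundle.continuous_proj F E) hproj

/-! ### The frame of the kernel -/

section Frame

variable {EB HB M EA HA F : Type*} {E A : M → Type*}
  [NormedAddCommGroup EB] [NormedSpace ℝ EB] [TopologicalSpace HB]
  {IB : ModelWithCorners ℝ EB HB} [TopologicalSpace M] [ChartedSpace HB M]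
  [NormedAddCommGroup F] [NormedSpace ℝ F]
  [∀ x, AddCommGroup (E x)] [∀ x, Module ℝ (E x)] [∀ x, TopologicalSpace (E x)]
  [TopologicalSpace (TotalSpace F E)] [FiberBundle F E] [VectorBundle ℝ F E]
  [ContMDiffVectorBundle ∞ F E IB]
  [NormedAddCommGroup EA] [NormedSpace ℝ EA] [TopologicalSpace HA]
  {IA : ModelWithCorners ℝ EA HA}
  [TopologicalSpace (TotalSpace F A)] [ChartedSpace HA (TotalSpace F A)]
  [∀ x, AddTorsor (E x) (A x)] [SmoothAffineBundle F E A IB IA]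

variable (E IB IA) in
include E in
theorem surjective_mfderiv_proj (a : TotalSpace F A) :
    Function.Surjective (mfderiv IA IB (π F A) a) := by
  obtain ⟨c, hac, hc⟩ := exists_isAffineTrivialization F E A IB IA a.1
  let s : M → TotalSpace F A := fun x => c.toOpenPartialHomeomorph.symm (x, (c a).2)
  have hsa : s a.1 = a := c.symm_apply_mk_proj (c.mem_source.2 hac)
  have hs : MDifferentiableAt IB IA s a.1 :=
    ((hc.contMDiffAt_symm (z := (a.1, (c a).2)) hac).comp a.1
      (contMDiffAt_id.prodMk contMDiffAt_const)).mdifferentiableAt (by simp)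
  have hproj : MDifferentiableAt IA IB (π F A) (s a.1) :=
    (SmoothAffineBundle.contMDiff_proj (F := F) (E := E) (A := A) (IB := IB)
      (IA := IA)).mdifferentiableAt (by simp)
  have hsection : π F A ∘ s =ᶠ[𝓝 a.1] id :=
    Filter.eventuallyEq_of_mem (c.open_baseSet.mem_nhds hac) fun x hx => c.proj_symm_apply' hx
  have hcomp (u : TangentSpace IB a.1) :
      mfderiv IA IB (π F A) (s a.1) (mfderiv IB IA s a.1 u) = u := by
    rw [← mfderiv_comp_apply a.1 hproj hs, hsection.mfderiv_eq, mfderiv_id]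
    rfl
  rw [← hsa]
  exact fun u => ⟨_, hcomp u⟩

variable [IsManifold IB ∞ M] {f : TotalSpace F A → ℝ} {a : TotalSpace F A}

theorem exists_mfderiv_fibreDeriv_add_dualVertLift_eq (hf : ContMDiffAt IA 𝓘(ℝ, ℝ) ∞ f a)
    (w : TangentSpace (IB.prod 𝓘(ℝ, F →L[ℝ] ℝ)) (fibreDeriv (E := E) f a)) :
    ∃ (v : TangentSpace IA a) (β : E a.1 →L[ℝ] ℝ),
      mfderiv IA (IB.prod 𝓘(ℝ, F →L[ℝ] ℝ)) (fibreDeriv (E := E) f) a v +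
        dualVertLift IB (fibreDeriv (E := E) f a) β = w := by
  obtain ⟨v, hv⟩ := surjective_mfderiv_proj E IB IA a
    (mfderiv (IB.prod 𝓘(ℝ, F →L[ℝ] ℝ)) IB (π (F →L[ℝ] ℝ) fun x => E x →L[ℝ] Trivial M ℝ x)
      (fibreDeriv (E := E) f a) w)
  have hvert : w - mfderiv IA (IB.prod 𝓘(ℝ, F →L[ℝ] ℝ)) (fibreDeriv (E := E) f) a v ∈
      LinearMap.range (dualVertLift IB (fibreDeriv (E := E) f a)) := by
    rw [dualVertLift, range_vertLiftTangent]
    refine LinearMap.mem_ker.2 ((map_sub _ _ _).trans (sub_eq_zero.2 ?_))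
    exact hv.symm.trans (mfderiv_proj_mfderiv_fibreDeriv hf v).symm
  obtain ⟨β, hβ⟩ := hvert
  exact ⟨v, β, (congrArg _ hβ).trans (add_sub_cancel _ w)⟩

variable [FiniteDimensional ℝ F] {U : Set (DualSpace F E)} {k : ℕ}
  {φ : Fin k → DualSpace F E → ℝ}

theorem linearIndependent_gammaMap (hf : ContMDiffAt IA 𝓘(ℝ, ℝ) ∞ f a)
    (hφ : DefinesOn (IB.prod 𝓘(ℝ, F →L[ℝ] ℝ)) φ (Set.range (fibreDeriv (E := E) f)) U)
    (ha : fibreDeriv f a ∈ U) : LinearIndependent ℝ fun μ => gammaMap f (φ μ) a := by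
  have hφ_diff (μ : Fin k) :
      MDifferentiableAt (IB.prod 𝓘(ℝ, F →L[ℝ] ℝ)) 𝓘(ℝ, ℝ) (φ μ) (fibreDeriv f a) :=
    (hφ.contMDiffAt ha μ).mdifferentiableAt (by simp)
  refine Fintype.linearIndependent_iff.2 fun c hc =>
    Fintype.linearIndependent_iff.1 (hφ.linearIndependent _ ⟨⟨a, rfl⟩, ha⟩) c ?_
  ext w
  obtain ⟨v, β, rfl⟩ := exists_mfderiv_fibreDeriv_add_dualVertLift_eq hf w
  have hterm (μ : Fin k) :
      mvfderiv (IB.prod 𝓘(ℝ, F →L[ℝ] ℝ)) (φ μ) (fibreDeriv f a)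
        (mfderiv IA (IB.prod 𝓘(ℝ, F →L[ℝ] ℝ)) (fibreDeriv (E := E) f) a v +
          dualVertLift IB (fibreDeriv (E := E) f a) β) = β (gammaMap f (φ μ) a) := by
    refine (ContinuousLinearMap.map_add _ _ _).trans ?_
    rw [mvfderiv_mfderiv_eq_zero_of_definesOn hφ ha
      ((contMDiffAt_fibreDeriv hf).mdifferentiableAt (by simp)), zero_add]
    exact mvfderiv_dualVertLift_eq_apply_gammaMap f (hφ_diff μ) β
  simp only [sum_apply, smul_apply, zero_apply, hterm]
  simpa only [map_sum, map_smul, map_zero] using congrArg β hc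

variable [FiniteDimensional ℝ EB] [IB.Boundaryless] [IA.Boundaryless]

theorem mem_range_fibreHessian_iff (hf : ContMDiffAt IA 𝓘(ℝ, ℝ) ∞ f a)
    (hreg : IsSubmersionOntoSubmanifold IA (IB.prod 𝓘(ℝ, F →L[ℝ] ℝ)) (fibreDeriv (E := E) f))
    (hφ : DefinesOn (IB.prod 𝓘(ℝ, F →L[ℝ] ℝ)) φ (Set.range (fibreDeriv (E := E) f)) U)
    (ha : fibreDeriv f a ∈ U) (β : E a.1 →L[ℝ] ℝ) :
    β ∈ Set.range (fibreHessian f a) ↔ ∀ μ, β (gammaMap f (φ μ) a) = 0 := by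
  have hφ_diff (μ : Fin k) :
      MDifferentiableAt (IB.prod 𝓘(ℝ, F →L[ℝ] ℝ)) 𝓘(ℝ, ℝ) (φ μ) (fibreDeriv f a) :=
    (hφ.contMDiffAt ha μ).mdifferentiableAt (by simp)
  calc
    β ∈ Set.range (fibreHessian f a) ↔ dualVertLift IB (fibreDeriv (E := E) f a) β ∈
        Set.range (mfderiv IA (IB.prod 𝓘(ℝ, F →L[ℝ] ℝ)) (fibreDeriv (E := E) f) a) := by
      simp only [Set.mem_range, mfderiv_fibreDeriv_eq_dualVertLift_iff hf]
      exact ⟨fun ⟨e, he⟩ => ⟨_, e, he, rfl⟩, fun ⟨_, e, he, _⟩ => ⟨e, he⟩⟩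
    _ ↔ ∀ μ, mvfderiv (IB.prod 𝓘(ℝ, F →L[ℝ] ℝ)) (φ μ) (fibreDeriv f a)
        (dualVertLift IB (fibreDeriv (E := E) f a) β) = 0 :=
      hreg.mem_range_mfderiv_iff hφ ha _
    _ ↔ ∀ μ, β (gammaMap f (φ μ) a) = 0 := by
      simp only [mvfderiv_dualVertLift_eq_apply_gammaMap f (hφ_diff _)]

theorem ker_fibreHessian_eq_span_gammaMap (hf : ContMDiffAt IA 𝓘(ℝ, ℝ) ∞ f a)
    (hreg : IsSubmersionOntoSubmanifold IA (IB.prod 𝓘(ℝ, F →L[ℝ] ℝ)) (fibreDeriv (E := E) f))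
    (hφ : DefinesOn (IB.prod 𝓘(ℝ, F →L[ℝ] ℝ)) φ (Set.range (fibreDeriv (E := E) f)) U)
    (ha : fibreDeriv f a ∈ U) :
    LinearMap.ker (fibreHessian (E := E) f a).toLinearMap =
      Submodule.span ℝ (Set.range fun μ => gammaMap f (φ μ) a) := by
  obtain ⟨_, _, _, _⟩ := finiteDimensional_fibre F E a.1
  let coe : (E a.1 →L[ℝ] ℝ) →ₗ[ℝ] Module.Dual ℝ (E a.1) := ContinuousLinearMap.coeLM ℝ
  have hcoe : LinearMap.ker coe = ⊥ :=
    LinearMap.ker_eq_bot.2 ContinuousLinearMap.coe_injective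
  rw [← LinearMap.ker_comp_of_ker_eq_bot _ hcoe]
  refine ker_eq_span_range_of_range_eq (fibreHessian_symm IB hf) fun α => ?_
  refine Iff.trans ?_
    (mem_range_fibreHessian_iff hf hreg hφ ha (LinearMap.toContinuousLinearMap α))
  refine exists_congr fun e => ?_
  rw [← ContinuousLinearMap.coe_injective.eq_iff]
  rfl

theorem isFrameOn_gammaField [IsManifold IA ∞ (TotalSpace F A)] (hf : ContMDiff IA 𝓘(ℝ, ℝ) ∞ f)
    (hreg : IsSubmersionOntoSubmanifold IA (IB.prod 𝓘(ℝ, F →L[ℝ] ℝ)) (fibreDeriv (E := E) f))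
    (hφ : DefinesOn (IB.prod 𝓘(ℝ, F →L[ℝ] ℝ)) φ (Set.range (fibreDeriv (E := E) f)) U) :
    IsFrameOn IA (fun μ => gammaField IB IA f (φ μ)) (kerHessianOp (E := E) IB IA f)
      (fibreDeriv (E := E) f ⁻¹' U) where
  contMDiffOn μ _ ha :=
    (contMDiffAt_gammaField hf.contMDiffAt (hφ.contMDiffAt ha μ)).contMDiffWithinAt
  linearIndependent a ha :=
    (linearIndependent_gammaMap hf.contMDiffAt hφ ha).map' (vertLiftTangent IB IA a)
      (ker_vertLiftTangent a)
  span_eq a ha := by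
    rw [kerHessianOp_eq_map_ker_fibreHessian,
      ker_fibreHessian_eq_span_gammaMap hf.contMDiffAt hreg hφ ha, Submodule.map_span,
      ← Set.range_comp]
    rfl

end Frame

end FibreDerivative

end

open FibreDerivative in
theorem proposition3_general
    {EB HB M EA HA F : Type*} {E A : M → Type*}
    [NormedAddCommGroup EB] [NormedSpace ℝ EB] [FiniteDimensional ℝ EB] [TopologicalSpace HB]
    (IB : ModelWithCorners ℝ EB HB) [IB.Boundaryless]
    [TopologicalSpace M] [T2Space M] [ChartedSpace HB M] [IsManifold IB ∞ M]
    [NormedAddCommGroup F] [NormedSpace ℝ F] [FiniteDimensional ℝ F]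
    [∀ x, AddCommGroup (E x)] [∀ x, Module ℝ (E x)] [∀ x, TopologicalSpace (E x)]
    [TopologicalSpace (TotalSpace F E)] [FiberBundle F E] [VectorBundle ℝ F E]
    [ContMDiffVectorBundle ∞ F E IB]
    [NormedAddCommGroup EA] [NormedSpace ℝ EA] [TopologicalSpace HA]
    (IA : ModelWithCorners ℝ EA HA) [IA.Boundaryless]
    [TopologicalSpace (TotalSpace F A)] [ChartedSpace HA (TotalSpace F A)]
    [IsManifold IA ∞ (TotalSpace F A)]
    [∀ x, AddTorsor (E x) (A x)] [SmoothAffineBundle F E A IB IA]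
    (f : TotalSpace F A → ℝ) (hf : ContMDiff IA 𝓘(ℝ, ℝ) ∞ f)
    (hreg : IsSubmersionOntoSubmanifold IA (IB.prod 𝓘(ℝ, F →L[ℝ] ℝ)) (fibreDeriv (E := E) f)) :
    (∀ a : TotalSpace F A,
      kerHessianOp (E := E) IB IA f a = kerTangentFibreDeriv (E := E) IB IA f a) ∧
    (∀ p ∈ Set.range (fibreDeriv (E := E) f),
      ∃ (U : Set (DualSpace F E)) (k : ℕ) (φ : Fin k → DualSpace F E → ℝ),
        p ∈ U ∧
        (∀ μ, ContMDiff (IB.prod 𝓘(ℝ, F →L[ℝ] ℝ)) 𝓘(ℝ, ℝ) ∞ (φ μ)) ∧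
        (∀ q ∈ U, LinearIndependent ℝ fun μ => mvfderiv (IB.prod 𝓘(ℝ, F →L[ℝ] ℝ)) (φ μ) q) ∧
        DefinesOn (IB.prod 𝓘(ℝ, F →L[ℝ] ℝ)) φ (Set.range (fibreDeriv (E := E) f)) U) ∧
    (∀ (U : Set (DualSpace F E)) (k : ℕ) (φ : Fin k → DualSpace F E → ℝ),
      DefinesOn (IB.prod 𝓘(ℝ, F →L[ℝ] ℝ)) φ (Set.range (fibreDeriv (E := E) f)) U →
      IsFrameOn IA (fun μ => gammaField IB IA f (φ μ)) (kerHessianOp (E := E) IB IA f)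
        (fibreDeriv (E := E) f ⁻¹' U)) := by
  have : T2Space (DualSpace F E) := t2Space_totalSpace _ _
  refine ⟨fun a => ?_, fun p hp => hreg.exists_definesOn hp,
    fun U k φ hφ => isFrameOn_gammaField hf hreg hφ⟩
  rw [kerHessianOp_eq_map_ker_fibreHessian,
    kerTangentFibreDeriv_eq_map_ker_fibreHessian hf.contMDiffAt]

theorem proposition3
    {EB HB M EA HA F : Type*} {E A : M → Type*}
    -- the base manifold `M`
    [NormedAddCommGroup EB] [NormedSpace ℝ EB] [FiniteDimensional ℝ EB] [TopologicalSpace HB]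
    (IB : ModelWithCorners ℝ EB HB) [IB.Boundaryless]
    [TopologicalSpace M] [T2Space M] [ChartedSpace HB M] [IsManifold IB ∞ M]
    -- the vector bundle `E → M`
    [NormedAddCommGroup F] [NormedSpace ℝ F] [FiniteDimensional ℝ F]
    [∀ x, AddCommGroup (E x)] [∀ x, Module ℝ (E x)] [∀ x, TopologicalSpace (E x)]
    [TopologicalSpace (TotalSpace F E)] [FiberBundle F E] [VectorBundle ℝ F E]
    [ContMDiffVectorBundle ∞ F E IB]
    -- the affine bundle `A → M` modelled on `E`
    [NormedAddCommGroup EA] [NormedSpace ℝ EA] [FiniteDimensional ℝ EA] [TopologicalSpace HA]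
    (IA : ModelWithCorners ℝ EA HA) [IA.Boundaryless]
    [TopologicalSpace (TotalSpace F A)] [ChartedSpace HA (TotalSpace F A)]
    [IsManifold IA ∞ (TotalSpace F A)]
    [∀ x, AddTorsor (E x) (A x)] [FibreDerivative.SmoothAffineBundle F E A IB IA]
    -- the almost regular function `f : A → ℝ`
    (f : TotalSpace F A → ℝ) (hf : ContMDiff IA 𝓘(ℝ, ℝ) ∞ f)
    (hreg : FibreDerivative.AlmostRegular E IB IA f) :
    -- `Ker Ŵ = Ker T𝓕`
    (∀ a : TotalSpace F A, FibreDerivative.kerHessianOp (E := E) IB IA f a =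
      FibreDerivative.kerTangentFibreDeriv (E := E) IB IA f a) ∧
    -- `𝓕(A)` is locally defined by the vanishing of independent functions
    (∀ p ∈ Set.range (FibreDerivative.fibreDeriv (E := E) f),
      ∃ (U : Set (FibreDerivative.DualSpace F E)) (k : ℕ)
        (φ : Fin k → FibreDerivative.DualSpace F E → ℝ),
        p ∈ U ∧
        (∀ μ, ContMDiff (IB.prod 𝓘(ℝ, F →L[ℝ] ℝ)) 𝓘(ℝ, ℝ) ∞ (φ μ)) ∧
        (∀ q ∈ U, LinearIndependent ℝ fun μ =>
          mvfderiv (IB.prod 𝓘(ℝ, F →L[ℝ] ℝ)) (φ μ) q) ∧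
        FibreDerivative.DefinesOn (IB.prod 𝓘(ℝ, F →L[ℝ] ℝ)) φ
          (Set.range (FibreDerivative.fibreDeriv (E := E) f)) U) ∧
    -- for any such functions `φ_μ`, the fields `Γ_{φ_μ}` are a frame of `Ker Ŵ`
    (∀ (U : Set (FibreDerivative.DualSpace F E)) (k : ℕ)
      (φ : Fin k → FibreDerivative.DualSpace F E → ℝ),
      FibreDerivative.DefinesOn (IB.prod 𝓘(ℝ, F →L[ℝ] ℝ)) φ
        (Set.range (FibreDerivative.fibreDeriv (E := E) f)) U →
      FibreDerivative.IsFrameOn IA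
        (fun μ => FibreDerivative.gammaField IB IA f (φ μ))
        (FibreDerivative.kerHessianOp (E := E) IB IA f)
        (FibreDerivative.fibreDeriv (E := E) f ⁻¹' U)) :=
  proposition3_general IB IA f hf hreg.isSubmersionOnto.2
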